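/- All algebras are associative algebras over $\mathbb K=\mathbb R$ or $\mathbb C$, not necessarily unital, and ideals are two-sided. A Fréchet algebra $(\mathcal A,p_n)$ is a complete Hausdorff topological algebra whose topology is defined by an increasing sequence $(p_n)_{n\in\mathbb N}$ of submultiplicative seminorms; a Banach algebra is regarded as the case in which every $p_n$ is the norm. For a closed ideal $I$ of $\mathcal A$ let $\tilde a=a+I$, let $\hat p_n(\tilde a)=\inf_{b\in I}p_n(a+b)$ be the quotient seminorms on $\mathcal A/I$, let $\hat r_n$ be the projective tensor seminorms $\hat p_n\otimes_\pi\hat p_n$ on the completed projective tensor product $\frac{\mathcal A}{I}\widehat\otimes\frac{\mathcal A}{I}$, and let $\pi:\frac{\mathcal A}{I}\widehat\otimes\frac{\mathcal A}{I}\to\frac{\mathcal A}{I}$ be the continuous linear map with $\pi(\tilde a\otimes\tilde b)=\widetilde{ab}$. The algebra $\mathcal A$ acts by $a\cdot\tilde b=\widetilde{ab}$, $a\cdot(\tilde b\otimes\tilde c)=\widetilde{ab}\otimes\tilde c$ and $(\tilde b\otimes\tilde c)\cdot a=\tilde b\otimes\widetilde{ca}$. $\mathcal A$ has a *bounded approximate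 diagonal modulo $I$* if there is a bounded net $(m_\alpha)$ in $\frac{\mathcal A}{I}\widehat\otimes\frac{\mathcal A}{I}$ such that $a\cdot\pi(m_\alpha)-\tilde a\to0$ for all $a\in\mathcal A$ and $a\cdot m_\alpha-m_\alpha\cdot a\to0$ for all $a\in\mathcal A\setminus I$. $\mathcal A$ has a *locally bounded approximate diagonal modulo $I$* if there are positive constants $(C_n)_{n\in\mathbb N}$ such that for each finite set $F\subseteq\mathcal A\setminus I$, each $n\in\mathbb N$ and each $\varepsilon>0$ there is $M\in\frac{\mathcal A}{I}\widehat\otimes\frac{\mathcal A}{I}$ with $\hat r_n(M)\le C_n$ and, for all $a\in F$, $\hat r_n(a\cdot M-M\cdot a)<\varepsilon$ and $\hat p_n(a\cdot\pi(M)-\tilde a)<\varepsilon$. **Proposition.** Let $(\mathcal A,p_n)$ be a Fréchet algebra and $I$ a closed ideal of $\mathcal A$. The following are equivalent: (i) $\mathcal A$ has a locally bounded approximate diagonal modulo $I$. (ii) For each Banach algebra $\mathcal B$, each continuous homomorphism $\varphi:\mathcal A\to\mathcal B$ with dense range, and each closed ideal $J$ of $\mathcal B$ with $\varphi(I)\subseteq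 J$, the Banach algebra $\mathcal B$ has a bounded approximate diagonal modulo $J$. -/

import Mathlib

open Filter Topology Set
open scoped TensorProduct

universe u

noncomputable section

/-! ### Seminorms on quotients, on algebraic tensor products and on completions -/

section Seminorms

variable {𝕜 E F : Type*} [RCLike 𝕜] [AddCommGroup E] [Module 𝕜 E] [AddCommGroup F] [Module 𝕜 F]

/-- The quotient seminorm `p̂ (x) = inf {p a : a + N = x}` on `E ⧸ N`. -/
def quotientSeminorm (p : Seminorm 𝕜 E) (N : Submodule 𝕜 E) : Seminorm 𝕜 (E ⧸ N) :=
  Seminorm.ofSMulLE (fun x => ⨅ a : {a : E // N.mkQ a = x}, p a)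
    (le_antisymm
      ((ciInf_le ⟨0, by rintro _ ⟨a, rfl⟩; exact apply_nonneg p _⟩
        (⟨0, map_zero _⟩ : {a : E // N.mkQ a = 0})).trans (by simp))
      (Real.iInf_nonneg fun a => apply_nonneg p _))
    (fun x y => by
      have : Nonempty {a : E // N.mkQ a = x} :=
        let ⟨a, ha⟩ := N.mkQ_surjective x; ⟨⟨a, ha⟩⟩
      have : Nonempty {a : E // N.mkQ a = y} :=
        let ⟨a, ha⟩ := N.mkQ_surjective y; ⟨⟨a, ha⟩⟩
      refine le_ciInf_add_ciInf fun a b => ?_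
      exact (ciInf_le ⟨0, by rintro _ ⟨a, rfl⟩; exact apply_nonneg p _⟩
        (⟨a.1 + b.1, by rw [map_add, a.2, b.2]⟩ : {a : E // N.mkQ a = x + y})).trans
        (map_add_le_add p _ _))
    (fun c x => by
      have : Nonempty {a : E // N.mkQ a = x} :=
        let ⟨a, ha⟩ := N.mkQ_surjective x; ⟨⟨a, ha⟩⟩
      rw [Real.mul_iInf_of_nonneg (norm_nonneg _)]
      refine le_ciInf fun a => ?_
      exact (ciInf_le ⟨0, by rintro _ ⟨a, rfl⟩; exact apply_nonneg p _⟩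
        (⟨c • a.1, by rw [map_smul, a.2]⟩ : {a : E // N.mkQ a = c • x})).trans
        (map_smul_eq_mul p _ _).le)

theorem quotientSeminorm_mk_le (p : Seminorm 𝕜 E) (N : Submodule 𝕜 E) (a : E) :
    quotientSeminorm p N (N.mkQ a) ≤ p a :=
  ciInf_le (f := fun b : {b : E // N.mkQ b = N.mkQ a} => p b)
    ⟨0, by rintro _ ⟨a, rfl⟩; exact apply_nonneg p _⟩ ⟨a, rfl⟩

theorem exists_lt_of_quotientSeminorm_lt (p : Seminorm 𝕜 E) (N : Submodule 𝕜 E) {x : E ⧸ N}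
    {r : ℝ} (h : quotientSeminorm p N x < r) : ∃ a, N.mkQ a = x ∧ p a < r := by
  have : Nonempty {a : E // N.mkQ a = x} :=
    let ⟨a, ha⟩ := N.mkQ_surjective x; ⟨⟨a, ha⟩⟩
  obtain ⟨a, ha⟩ := exists_lt_of_ciInf_lt
    (f := fun b : {b : E // N.mkQ b = x} => p b) h
  exact ⟨a.1, a.2, ha⟩

theorem exists_tensor_list (u : E ⊗[𝕜] F) :
    ∃ l : List (E × F), (l.map fun x => x.1 ⊗ₜ[𝕜] x.2).sum = u := by
  induction u using TensorProduct.induction_on with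
  | zero => exact ⟨[], by simp⟩
  | tmul x y => exact ⟨[(x, y)], by simp⟩
  | add u v hu hv =>
    obtain ⟨l, rfl⟩ := hu
    obtain ⟨m, rfl⟩ := hv
    exact ⟨l ++ m, by simp⟩

theorem tensor_list_sum_nonneg (p : Seminorm 𝕜 E) (q : Seminorm 𝕜 F) (l : List (E × F)) :
    0 ≤ (l.map fun x => p x.1 * q x.2).sum :=
  List.sum_nonneg (by
    intro r hr
    obtain ⟨x, -, rfl⟩ := List.mem_map.1 hr
    exact mul_nonneg (apply_nonneg _ _) (apply_nonneg _ _))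

theorem tensor_list_bddBelow (p : Seminorm 𝕜 E) (q : Seminorm 𝕜 F) (u : E ⊗[𝕜] F) :
    BddBelow (range fun l : {l : List (E × F) // (l.map fun x => x.1 ⊗ₜ[𝕜] x.2).sum = u} =>
      (l.1.map fun x => p x.1 * q x.2).sum) :=
  ⟨0, by rintro _ ⟨l, rfl⟩; exact tensor_list_sum_nonneg p q _⟩

/-- The projective tensor seminorm `u ↦ inf {∑ᵢ p (aᵢ) q (bᵢ) : u = ∑ᵢ aᵢ ⊗ bᵢ}` on `E ⊗ F`
(the infimum is over all representations of `u` as a finite sum). -/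
def projectiveTensorSeminorm (p : Seminorm 𝕜 E) (q : Seminorm 𝕜 F) : Seminorm 𝕜 (E ⊗[𝕜] F) :=
  Seminorm.ofSMulLE
    (fun u => ⨅ l : {l : List (E × F) // (l.map fun x => x.1 ⊗ₜ[𝕜] x.2).sum = u},
      (l.1.map fun x => p x.1 * q x.2).sum)
    (le_antisymm
      ((ciInf_le (tensor_list_bddBelow p q 0) ⟨[], by simp⟩).trans (by simp))
      (Real.iInf_nonneg fun l => tensor_list_sum_nonneg p q _))
    (fun u v => by
      have : Nonempty {l : List (E × F) // (l.map fun x => x.1 ⊗ₜ[𝕜] x.2).sum = u} :=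
        let ⟨l, hl⟩ := exists_tensor_list u; ⟨⟨l, hl⟩⟩
      have : Nonempty {l : List (E × F) // (l.map fun x => x.1 ⊗ₜ[𝕜] x.2).sum = v} :=
        let ⟨l, hl⟩ := exists_tensor_list v; ⟨⟨l, hl⟩⟩
      refine le_ciInf_add_ciInf fun l m => ?_
      exact (ciInf_le (tensor_list_bddBelow p q (u + v))
        ⟨l.1 ++ m.1, by rw [List.map_append, List.sum_append, l.2, m.2]⟩).trans (by simp))
    (fun c u => by
      have : Nonempty {l : List (E × F) // (l.map fun x => x.1 ⊗ₜ[𝕜] x.2).sum = u} :=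
        let ⟨l, hl⟩ := exists_tensor_list u; ⟨⟨l, hl⟩⟩
      rw [Real.mul_iInf_of_nonneg (norm_nonneg _)]
      refine le_ciInf fun l => ?_
      refine (ciInf_le (tensor_list_bddBelow p q (c • u))
        ⟨l.1.map fun x => (c • x.1, x.2), ?_⟩).trans ?_
      · refine Eq.trans ?_ (congrArg (c • ·) l.2)
        simp [Function.comp_def, TensorProduct.smul_tmul', List.smul_sum]
      · simp [Function.comp_def, map_smul_eq_mul, mul_assoc, List.sum_map_mul_left])

theorem projectiveTensorSeminorm_le (p : Seminorm 𝕜 E) (q : Seminorm 𝕜 F) (l : List (E × F)) :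
    projectiveTensorSeminorm p q (l.map fun x => x.1 ⊗ₜ[𝕜] x.2).sum ≤
      (l.map fun x => p x.1 * q x.2).sum :=
  ciInf_le (tensor_list_bddBelow p q _) ⟨l, rfl⟩

theorem le_projectiveTensorSeminorm (p : Seminorm 𝕜 E) (q : Seminorm 𝕜 F) (u : E ⊗[𝕜] F) {r : ℝ}
    (h : ∀ l : List (E × F), (l.map fun x => x.1 ⊗ₜ[𝕜] x.2).sum = u →
      r ≤ (l.map fun x => p x.1 * q x.2).sum) : r ≤ projectiveTensorSeminorm p q u := by
  have : Nonempty {l : List (E × F) // (l.map fun x => x.1 ⊗ₜ[𝕜] x.2).sum = u} :=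
    let ⟨l, hl⟩ := exists_tensor_list u; ⟨⟨l, hl⟩⟩
  exact le_ciInf fun l => h l.1 l.2

/-- A linear map out of `E ⊗ F` whose values on elementary tensors are bounded by `c p(a) q(b)`
is bounded by `c` times the projective tensor seminorm. -/
theorem bound_of_bound_tmul {G : Type*} [AddCommGroup G] [Module 𝕜 G] (p : Seminorm 𝕜 E)
    (q : Seminorm 𝕜 F) (s : Seminorm 𝕜 G) (T : E ⊗[𝕜] F →ₗ[𝕜] G) {c : ℝ} (hc : 0 ≤ c)
    (h : ∀ a b, s (T (a ⊗ₜ[𝕜] b)) ≤ c * (p a * q b)) (u : E ⊗[𝕜] F) :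
    s (T u) ≤ c * projectiveTensorSeminorm p q u := by
  have key : ∀ l : List (E × F), s (T (l.map fun x => x.1 ⊗ₜ[𝕜] x.2).sum) ≤
      c * (l.map fun x => p x.1 * q x.2).sum := by
    intro l
    induction l with
    | nil => simp
    | cons x l ih =>
      simp only [List.map_cons, List.sum_cons, map_add, mul_add]
      exact (map_add_le_add s _ _).trans (add_le_add (h _ _) ih)
  rcases hc.eq_or_lt with rfl | hc'
  · obtain ⟨l, rfl⟩ := exists_tensor_list u
    simpa using key l
  · rw [← div_le_iff₀' hc']
    refine le_projectiveTensorSeminorm p q u fun l hl => ?_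
    rw [div_le_iff₀' hc', ← hl]
    exact key l

/-- The continuous extension of a continuous seminorm to the completion. -/
def completionSeminorm [UniformSpace E] [IsUniformAddGroup E] [UniformContinuousConstSMul 𝕜 E]
    (r : Seminorm 𝕜 E) (hr : Continuous r) : Seminorm 𝕜 (UniformSpace.Completion E) :=
  have hu : UniformContinuous r := Seminorm.uniformContinuous_of_continuousAt_zero hr.continuousAt
  Seminorm.of (UniformSpace.Completion.extension r)
    (fun x y => by
      induction x, y using UniformSpace.Completion.induction_on₂ with
      | hp =>
        exact isClosed_le
          (UniformSpace.Completion.continuous_extension.comp (continuous_fst.add continuous_snd))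
          ((UniformSpace.Completion.continuous_extension.comp continuous_fst).add
            (UniformSpace.Completion.continuous_extension.comp continuous_snd))
      | ih x y =>
        rw [← UniformSpace.Completion.coe_add, UniformSpace.Completion.extension_coe hu,
          UniformSpace.Completion.extension_coe hu, UniformSpace.Completion.extension_coe hu]
        exact map_add_le_add r x y)
    (fun c x => by
      induction x using UniformSpace.Completion.induction_on with
      | hp =>
        exact isClosed_eq
          (UniformSpace.Completion.continuous_extension.comp (continuous_const_smul c))
          (continuous_const.mul UniformSpace.Completion.continuous_extension)
      | ih x =>
        rw [← UniformSpace.Completion.coe_smul, UniformSpace.Completion.extension_coe hu,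
          UniformSpace.Completion.extension_coe hu]
        exact map_smul_eq_mul r c x)

end Seminorms

/-! ### The completed projective tensor product -/

section ProjTensor

variable {𝕜 E F : Type*} [RCLike 𝕜] [AddCommGroup E] [Module 𝕜 E] [AddCommGroup F] [Module 𝕜 F]

/-- The algebraic tensor product `E ⊗ F` of two spaces whose topologies are given by increasing
sequences of seminorms `p` and `q`, to be endowed with the projective topology, that is, the
topology given by the seminorms `projectiveTensorSeminorm (p n) (q n)`. -/
def ProjTensor (_p : ℕ → Seminorm 𝕜 E) (_q : ℕ → Seminorm 𝕜 F) : Type _ := E ⊗[𝕜] F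

namespace ProjTensor

variable (p : ℕ → Seminorm 𝕜 E) (q : ℕ → Seminorm 𝕜 F)

instance : AddCommGroup (ProjTensor p q) := inferInstanceAs (AddCommGroup (E ⊗[𝕜] F))

instance : Module 𝕜 (ProjTensor p q) := inferInstanceAs (Module 𝕜 (E ⊗[𝕜] F))

/-- The seminorms `r_n` on the algebraic tensor product. -/
def seminormFamily : SeminormFamily 𝕜 (ProjTensor p q) ℕ :=
  fun n => projectiveTensorSeminorm (p n) (q n)

instance : TopologicalSpace (ProjTensor p q) :=
  (seminormFamily p q).moduleFilterBasis.topology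

theorem withSeminorms : WithSeminorms (seminormFamily p q) := ⟨rfl⟩

instance : IsTopologicalAddGroup (ProjTensor p q) := (withSeminorms p q).topologicalAddGroup

instance : ContinuousSMul 𝕜 (ProjTensor p q) := (withSeminorms p q).continuousSMul

instance : UniformSpace (ProjTensor p q) := IsTopologicalAddGroup.rightUniformSpace _

instance : IsUniformAddGroup (ProjTensor p q) := isUniformAddGroup_of_addCommGroup

instance : UniformContinuousConstSMul 𝕜 (ProjTensor p q) :=
  uniformContinuousConstSMul_of_continuousConstSMul 𝕜 _

end ProjTensor

/-- The completed projective tensor product `E ⊗̂ F`. -/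
abbrev CompletedProjTensor (p : ℕ → Seminorm 𝕜 E) (q : ℕ → Seminorm 𝕜 F) : Type _ :=
  UniformSpace.Completion (ProjTensor p q)

namespace CompletedProjTensor

variable (p : ℕ → Seminorm 𝕜 E) (q : ℕ → Seminorm 𝕜 F)

/-- The seminorms `r_n` on `E ⊗̂ F`; they define its topology. -/
def seminorm (n : ℕ) : Seminorm 𝕜 (CompletedProjTensor p q) :=
  completionSeminorm (ProjTensor.seminormFamily p q n)
    ((ProjTensor.withSeminorms p q).continuous_seminorm n)

/-- The operator `f ⊗̂ g` on `E ⊗̂ F` given by linear operators `f`, `g` that are bounded for each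
of the seminorms. -/
def map (f : E →ₗ[𝕜] E) (g : F →ₗ[𝕜] F)
    (hf : ∀ n, ∃ c : ℝ, 0 ≤ c ∧ ∀ x, p n (f x) ≤ c * p n x)
    (hg : ∀ n, ∃ c : ℝ, 0 ≤ c ∧ ∀ y, q n (g y) ≤ c * q n y) :
    CompletedProjTensor p q →L[𝕜] CompletedProjTensor p q :=
  ContinuousLinearMap.completion (α := ProjTensor p q) (β := ProjTensor p q)
    { toLinearMap := (TensorProduct.map f g : E ⊗[𝕜] F →ₗ[𝕜] E ⊗[𝕜] F)
      cont := by
        refine WithSeminorms.continuous_of_isBounded (ProjTensor.withSeminorms p q)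
          (ProjTensor.withSeminorms p q) _ ?_
        refine Seminorm.IsBounded.of_real fun n => ?_
        obtain ⟨c, hc, hcf⟩ := hf n
        obtain ⟨d, hd, hdg⟩ := hg n
        refine ⟨{n}, c * d, fun u => ?_⟩
        rw [Finset.sup_singleton]
        refine bound_of_bound_tmul (p n) (q n) (projectiveTensorSeminorm (p n) (q n)) _
          (mul_nonneg hc hd) (fun a b => ?_) u
        rw [TensorProduct.map_tmul]
        refine (by simpa using projectiveTensorSeminorm_le (p n) (q n) [(f a, g b)] :
          projectiveTensorSeminorm (p n) (q n) (f a ⊗ₜ[𝕜] g b) ≤ p n (f a) * q n (g b)).trans ?_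
        calc p n (f a) * q n (g b) ≤ (c * p n a) * (d * q n b) :=
              mul_le_mul (hcf a) (hdg b) (apply_nonneg _ _)
                (mul_nonneg hc (apply_nonneg _ _))
          _ = c * d * (p n a * q n b) := by ring }

end CompletedProjTensor

end ProjTensor

/-! ### Fréchet algebras and their closed ideals -/

/-- An increasing sequence of submultiplicative seminorms that defines the topology of the algebra
`A`. A Fréchet algebra `(A, p_n)` is a complete Hausdorff topological algebra with such a
sequence. -/
structure FrechetSeminorms (𝕜 A : Type*) [RCLike 𝕜] [NonUnitalRing A] [Module 𝕜 A]
    [TopologicalSpace A] where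
  /-- The seminorms `p_n`. -/
  p : ℕ → Seminorm 𝕜 A
  mono : Monotone p
  submul : ∀ n a b, p n (a * b) ≤ p n a * p n b
  withSeminorms : WithSeminorms p

/-- A closed two-sided ideal of the algebra `A`. -/
structure ClosedIdeal (𝕜 A : Type*) [RCLike 𝕜] [NonUnitalRing A] [Module 𝕜 A]
    [TopologicalSpace A] extends Submodule 𝕜 A where
  mul_mem_left : ∀ a x : A, x ∈ carrier → a * x ∈ carrier
  mul_mem_right : ∀ a x : A, x ∈ carrier → x * a ∈ carrier
  isClosed : IsClosed carrier

/-- A Banach algebra is a Fréchet algebra, all the seminorms being equal to the norm. -/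
def FrechetSeminorms.ofNorm (𝕜 B : Type*) [RCLike 𝕜] [NonUnitalNormedRing B] [NormedSpace 𝕜 B] :
    FrechetSeminorms 𝕜 B where
  p _ := normSeminorm 𝕜 B
  mono := monotone_const
  submul _ a b := norm_mul_le a b
  withSeminorms := (norm_withSeminorms 𝕜 B).congr
    (Seminorm.IsBounded.of_real fun _ => ⟨{0}, 1, fun x => by simp⟩)
    (Seminorm.IsBounded.of_real fun _ => ⟨{0}, 1, fun x => by simp⟩)

section Diagonal

variable {𝕜 A : Type*} [RCLike 𝕜] [NonUnitalRing A] [Module 𝕜 A] [IsScalarTower 𝕜 A A]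
  [SMulCommClass 𝕜 A A]

namespace ClosedIdeal

variable [TopologicalSpace A] (I : ClosedIdeal 𝕜 A)

/-- The quotient `A / I`. -/
abbrev Quot : Type _ := A ⧸ I.toSubmodule

/-- The quotient map `a ↦ ã = a + I`. -/
abbrev proj : A →ₗ[𝕜] I.Quot := I.toSubmodule.mkQ

/-- The left action `b + I ↦ a b + I` of `a : A` on `A / I`. -/
def lmul (a : A) : I.Quot →ₗ[𝕜] I.Quot :=
  I.toSubmodule.mapQ I.toSubmodule (LinearMap.mulLeft 𝕜 a) fun x hx => I.mul_mem_left a x hx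

/-- The right action `b + I ↦ b a + I` of `a : A` on `A / I`. -/
def rmul (a : A) : I.Quot →ₗ[𝕜] I.Quot :=
  I.toSubmodule.mapQ I.toSubmodule (LinearMap.mulRight 𝕜 a) fun x hx => I.mul_mem_right a x hx

/-- The multiplication `(a + I, b + I) ↦ a b + I` of `A / I`, as a bilinear map. -/
def mulQuot : I.Quot →ₗ[𝕜] I.Quot →ₗ[𝕜] I.Quot :=
  I.toSubmodule.liftQ
    { toFun := fun a => I.lmul a
      map_add' := fun a b => by
        ext x; exact congrArg I.proj (add_mul a b x)
      map_smul' := fun c a => by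
        ext x; exact congrArg I.proj (smul_mul_assoc c a x) }
    fun a ha => by
      rw [LinearMap.mem_ker]
      ext x
      exact (Submodule.Quotient.mk_eq_zero _).2 (I.mul_mem_right x a ha)

theorem mulQuot_proj (a b : A) : I.mulQuot (I.proj a) (I.proj b) = I.proj (a * b) := rfl

end ClosedIdeal

namespace FrechetSeminorms

section

variable [TopologicalSpace A] (S : FrechetSeminorms 𝕜 A) (I : ClosedIdeal 𝕜 A)

/-- The quotient seminorms `p̂_n (a + I) = inf {p_n (a + b) : b ∈ I}` on `A / I`. -/
def pHat (n : ℕ) : Seminorm 𝕜 I.Quot := quotientSeminorm (S.p n) I.toSubmodule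

theorem pHat_mulQuot_le (n : ℕ) (x y : I.Quot) :
    S.pHat I n (I.mulQuot x y) ≤ S.pHat I n x * S.pHat I n y := by
  have h : ∀ ε : ℝ, 0 < ε →
      S.pHat I n (I.mulQuot x y) ≤ (S.pHat I n x + ε) * (S.pHat I n y + ε) := by
    intro ε hε
    obtain ⟨a, rfl, ha⟩ := exists_lt_of_quotientSeminorm_lt (S.p n) I.toSubmodule
      (lt_add_of_pos_right (S.pHat I n x) hε)
    obtain ⟨b, rfl, hb⟩ := exists_lt_of_quotientSeminorm_lt (S.p n) I.toSubmodule
      (lt_add_of_pos_right (S.pHat I n y) hε)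
    rw [I.mulQuot_proj]
    refine (quotientSeminorm_mk_le (S.p n) I.toSubmodule (a * b)).trans
      ((S.submul n a b).trans (mul_le_mul ha.le hb.le (apply_nonneg _ _) ?_))
    exact add_nonneg (apply_nonneg _ _) hε.le
  have ht : Tendsto (fun ε : ℝ => (S.pHat I n x + ε) * (S.pHat I n y + ε)) (𝓝[>] 0)
      (𝓝 (S.pHat I n x * S.pHat I n y)) := by
    refine Tendsto.mono_left ?_ nhdsWithin_le_nhds
    have : Continuous fun ε : ℝ => (S.pHat I n x + ε) * (S.pHat I n y + ε) := by fun_prop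
    simpa using this.tendsto 0
  exact ge_of_tendsto ht (eventually_nhdsWithin_of_forall h)

theorem pHat_lmul_le (n : ℕ) (a : A) (x : I.Quot) :
    S.pHat I n (I.lmul a x) ≤ S.p n a * S.pHat I n x :=
  (S.pHat_mulQuot_le I n (I.proj a) x).trans
    (mul_le_mul_of_nonneg_right (quotientSeminorm_mk_le _ _ _) (apply_nonneg _ _))

theorem pHat_rmul_le (n : ℕ) (a : A) (x : I.Quot) :
    S.pHat I n (I.rmul a x) ≤ S.p n a * S.pHat I n x := by
  obtain ⟨b, rfl⟩ := I.toSubmodule.mkQ_surjective x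
  refine (S.pHat_mulQuot_le I n (I.proj b) (I.proj a)).trans ?_
  rw [mul_comm]
  exact mul_le_mul_of_nonneg_right (quotientSeminorm_mk_le _ _ _) (apply_nonneg _ _)

/-- `A / I ⊗̂ A / I`. -/
abbrev QuotTensor : Type _ := CompletedProjTensor (S.pHat I) (S.pHat I)

/-- The seminorms `r̂_n` on `A / I ⊗̂ A / I`. -/
abbrev rHat (n : ℕ) : Seminorm 𝕜 (S.QuotTensor I) :=
  CompletedProjTensor.seminorm (S.pHat I) (S.pHat I) n

/-- The left action of `A` on `A / I ⊗̂ A / I`, given by `a · (x ⊗ y) = a x ⊗ y`. -/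
def lact (a : A) : S.QuotTensor I →L[𝕜] S.QuotTensor I :=
  CompletedProjTensor.map _ _ (I.lmul a) LinearMap.id
    (fun n => ⟨S.p n a, apply_nonneg _ _, S.pHat_lmul_le I n a⟩)
    (fun _ => ⟨1, zero_le_one, fun _ => by simp⟩)

/-- The right action of `A` on `A / I ⊗̂ A / I`, given by `(x ⊗ y) · a = x ⊗ y a`. -/
def ract (a : A) : S.QuotTensor I →L[𝕜] S.QuotTensor I :=
  CompletedProjTensor.map _ _ LinearMap.id (I.rmul a)
    (fun _ => ⟨1, zero_le_one, fun _ => by simp⟩)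
    (fun n => ⟨S.p n a, apply_nonneg _ _, S.pHat_rmul_le I n a⟩)

/-- The quotient topology of `A / I` is defined by the seminorms `p̂_n`. -/
theorem withSeminorms_pHat [IsTopologicalAddGroup A] : WithSeminorms (S.pHat I) := by
  rw [SeminormFamily.withSeminorms_iff_nhds_eq_iInf]
  have h0 : 𝓝 (0 : I.Quot) = map I.proj (𝓝 0) := by
    rw [← map_zero I.proj]
    exact (I.toSubmodule.isOpenQuotientMap_mkQ.map_nhds_eq 0).symm
  refine le_antisymm (le_iInf fun n => ?_) fun U hU => ?_
  · rw [← tendsto_iff_comap, h0, tendsto_map'_iff]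
    have hc : Tendsto (S.p n) (𝓝 0) (𝓝 0) := by
      simpa using (S.withSeminorms.continuous_seminorm n).tendsto 0
    exact squeeze_zero (fun a => apply_nonneg _ _)
      (fun a => quotientSeminorm_mk_le (S.p n) I.toSubmodule a) hc
  · rw [h0, mem_map] at hU
    obtain ⟨⟨s, r⟩, hr, hs⟩ := S.withSeminorms.hasBasis_zero_ball.mem_iff.1 hU
    obtain ⟨N, hN⟩ := s.exists_le
    refine mem_iInf_of_mem N (mem_comap.2 ⟨Iio r, Iio_mem_nhds hr, fun x hx => ?_⟩)
    obtain ⟨a, rfl, ha⟩ := exists_lt_of_quotientSeminorm_lt (S.p N) I.toSubmodule hx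
    refine hs ?_
    rw [Seminorm.mem_ball_zero]
    exact (Seminorm.finset_sup_apply_le (apply_nonneg _ _) (fun i hi => S.mono (hN i hi) a)).trans_lt ha

end

variable [UniformSpace A] [IsUniformAddGroup A] [CompleteSpace A]
  (S : FrechetSeminorms 𝕜 A) (I : ClosedIdeal 𝕜 A)

/-- The diagonal operator `π : A / I ⊗̂ A / I → A / I`, `(a + I) ⊗ (b + I) ↦ a b + I`, where
`A / I` has the quotient topology. -/
def diagonalMap : S.QuotTensor I →L[𝕜] I.Quot :=
  have : FirstCountableTopology A := S.withSeminorms.firstCountableTopology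
  have : ContinuousSMul 𝕜 A := S.withSeminorms.continuousSMul
  have : IsClosed (I.toSubmodule : Set A) := I.isClosed
  letI : UniformSpace I.Quot := IsTopologicalAddGroup.rightUniformSpace _
  have : IsUniformAddGroup I.Quot := isUniformAddGroup_of_addCommGroup
  have : CompleteSpace I.Quot := QuotientAddGroup.completeSpace_right A I.toSubmodule.toAddSubgroup
  have : ContinuousSMul 𝕜 I.Quot := (S.withSeminorms_pHat I).continuousSMul
  have : UniformContinuousConstSMul 𝕜 I.Quot :=
    uniformContinuousConstSMul_of_continuousConstSMul 𝕜 _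
  ContinuousLinearMap.fromCompletion (α := ProjTensor (S.pHat I) (S.pHat I)) (β := I.Quot)
    { toLinearMap := (TensorProduct.lift I.mulQuot : I.Quot ⊗[𝕜] I.Quot →ₗ[𝕜] I.Quot)
      cont := by
        refine WithSeminorms.continuous_of_isBounded (ProjTensor.withSeminorms _ _)
          (S.withSeminorms_pHat I) _ ?_
        refine Seminorm.IsBounded.of_real fun n => ⟨{n}, 1, fun u => ?_⟩
        rw [Finset.sup_singleton]
        exact bound_of_bound_tmul (S.pHat I n) (S.pHat I n) (S.pHat I n)
          (TensorProduct.lift I.mulQuot) zero_le_one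
          (fun x y => by simpa using S.pHat_mulQuot_le I n x y) u }

/-- `A` has a bounded approximate diagonal modulo `I`: there is a bounded net `(m_i)` in
`A / I ⊗̂ A / I` such that `a · π (m_i) - ã → 0` in `A / I` for all `a ∈ A` and
`a · m_i - m_i · a → 0` in `A / I ⊗̂ A / I` for all `a ∈ A \ I`. -/
def HasBoundedApproximateDiagonalMod {𝕜 : Type*} {A : Type u} [RCLike 𝕜] [NonUnitalRing A]
    [Module 𝕜 A] [IsScalarTower 𝕜 A A] [SMulCommClass 𝕜 A A] [UniformSpace A]
    [IsUniformAddGroup A] [CompleteSpace A]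
    (S : FrechetSeminorms 𝕜 A) (I : ClosedIdeal 𝕜 A) : Prop :=
  ∃ (ι : Type u) (_ : Preorder ι) (_ : IsDirectedOrder ι) (_ : Nonempty ι)
    (m : ι → S.QuotTensor I),
    (∀ n, ∃ C : ℝ, ∀ i, S.rHat I n (m i) ≤ C) ∧
    (∀ a : A, Tendsto (fun i => I.lmul a (S.diagonalMap I (m i)) - I.proj a) atTop (𝓝 0)) ∧
    (∀ a : A, a ∉ I.toSubmodule →
      Tendsto (fun i => S.lact I a (m i) - S.ract I a (m i)) atTop (𝓝 0))

/-- `A` has a locally bounded approximate diagonal modulo `I`: there are constants `C_n > 0` such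
that for each finite `F ⊆ A \ I`, each `n` and each `ε > 0` there is `M` in `A / I ⊗̂ A / I` with
`r̂_n (M) ≤ C_n`, and `r̂_n (a · M - M · a) < ε`, `p̂_n (a · π (M) - ã) < ε` for all `a ∈ F`. -/
def HasLocallyBoundedApproximateDiagonalMod : Prop :=
  ∃ C : ℕ → ℝ, (∀ n, 0 < C n) ∧
    ∀ F : Finset A, (∀ a ∈ F, a ∉ I.toSubmodule) → ∀ n : ℕ, ∀ ε : ℝ, 0 < ε →
      ∃ M : S.QuotTensor I, S.rHat I n M ≤ C n ∧
        (∀ a ∈ F, S.rHat I n (S.lact I a M - S.ract I a M) < ε) ∧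
        (∀ a ∈ F, S.pHat I n (I.lmul a (S.diagonalMap I M) - I.proj a) < ε)

end FrechetSeminorms

end Diagonal

end

set_option linter.unusedSectionVars false

/-! Both implications move approximate diagonals along the map `A / I ⊗̂ A / I → B / J ⊗̂ B / J`
induced by `φ`, which intertwines the actions of `a` and `φ a` and the two diagonal operators. The
restriction to elements outside the ideal costs nothing: elements of `I` act as zero on `A / I`, so
their commutators and unit defects vanish.

(i) ⇒ (ii). The norm of `B` is controlled through `φ` by a single seminorm, `‖φ a‖ ≤ K p_n(a)`.
Images of the local solutions `M` at level `n` therefore have norm at most `K² C_n`, whatever the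
finite set and the tolerance. Density of the range and this common bound carry the estimates from
`φ(A)` to finite subsets of `B`, and solutions for all finite sets and tolerances form a bounded
net.

(ii) ⇒ (i). Each `n` is treated separately. Let `B` be the completion of `A` for the seminorm `a ↦
p̂_n(a + I)`. The canonical map kills `I`, so `J = 0` is admissible, and `A / I → B` is isometric
for `p̂_n` with dense range. The bound of the net in `B ⊗̂ B` yields `C_n`, provided its members can
be approximated from `A / I ⊗̂ A / I` with control of `r̂_n`. This is the main point: projective
tensor seminorms are in general not inherited by subspaces, but they are by dense ones
(`projectiveTensorSeminorm_map_eq`), because bounded bilinear forms extend from a dense subspace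
with the same bound. The approximation is carried out in `exists_of_quotMap_isometry`. -/

noncomputable section

/-! ### Projective tensor seminorms and dense isometries -/

section DenseIsometry

/-- The dual of a seminormed space is a normed space. -/
instance strongDualNormedAddCommGroup {𝕜 E : Type*} [RCLike 𝕜] [SeminormedAddCommGroup E]
    [NormedSpace 𝕜 E] : NormedAddCommGroup (E →L[𝕜] 𝕜) :=
  NormedAddCommGroup.ofSeparation fun f hf => by
    ext x
    simpa [hf] using f.le_opNorm x

/-- One variable is extended at a time: the form is read as a map `E → E*` and extended along `f` to
`X → E*`; after a flip the other variable is extended in the same way. The targets are duals, hence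
Banach spaces, and since `f` is isometric the constant stays `1`. -/
theorem exists_bilinear_extension {𝕜 E X : Type*} [RCLike 𝕜] [SeminormedAddCommGroup E]
    [NormedSpace 𝕜 E] [SeminormedAddCommGroup X] [NormedSpace 𝕜 X] (f : E →ₗ[𝕜] X)
    (hf : ∀ x, ‖f x‖ = ‖x‖) (hd : DenseRange f) (b : E →ₗ[𝕜] E →ₗ[𝕜] 𝕜)
    (hb : ∀ x y, ‖b x y‖ ≤ ‖x‖ * ‖y‖) :
    ∃ b' : X →ₗ[𝕜] X →ₗ[𝕜] 𝕜, (∀ x y, b' (f x) (f y) = b x y) ∧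
      ∀ x y, ‖b' x y‖ ≤ ‖x‖ * ‖y‖ := by
  let b₀ : E →L[𝕜] E →L[𝕜] 𝕜 := b.mkContinuous₂ 1 fun x y => by simpa using hb x y
  have h₀ : ∀ x, ‖b₀.toLinearMap x‖ ≤ 1 * ‖f x‖ := fun x => by
    rw [one_mul, hf]
    exact ContinuousLinearMap.opNorm_le_bound _ (norm_nonneg _) fun y => hb x y
  let c₁ : X →L[𝕜] E →L[𝕜] 𝕜 := LinearMap.extendOfNorm (F := E →L[𝕜] 𝕜) b₀.toLinearMap f
  let b₁ : E →L[𝕜] X →L[𝕜] 𝕜 := c₁.flip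
  have e₁ : ∀ x y, b₁ y (f x) = b x y := fun x y =>
    congrArg (fun T : E →L[𝕜] 𝕜 => T y) (LinearMap.extendOfNorm_eq hd ⟨1, h₀⟩ x)
  have h₁ : ∀ y, ‖b₁.toLinearMap y‖ ≤ 1 * ‖f y‖ := fun y => by
    rw [one_mul, hf]
    refine ContinuousLinearMap.opNorm_le_bound _ (norm_nonneg _) fun x => ?_
    refine ((c₁ x).le_opNorm y).trans ?_
    rw [mul_comm]
    refine mul_le_mul_of_nonneg_left ?_ (norm_nonneg _)
    simpa using LinearMap.norm_extendOfNorm_apply_le hd 1 h₀ x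
  let c₂ : X →L[𝕜] X →L[𝕜] 𝕜 := LinearMap.extendOfNorm (F := X →L[𝕜] 𝕜) b₁.toLinearMap f
  let b₂ : X →L[𝕜] X →L[𝕜] 𝕜 := c₂.flip
  have e₂ : ∀ x y, b₂ x (f y) = b₁ y x := fun x y =>
    congrArg (fun T : X →L[𝕜] 𝕜 => T x) (LinearMap.extendOfNorm_eq hd ⟨1, h₁⟩ y)
  refine ⟨ContinuousLinearMap.toLinearMap₁₂ b₂, fun x y => (e₂ _ _).trans (e₁ _ _),
    fun x y => ?_⟩
  refine ((c₂ y).le_opNorm x).trans ?_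
  rw [mul_comm]
  refine mul_le_mul_of_nonneg_left ?_ (norm_nonneg _)
  simpa using LinearMap.norm_extendOfNorm_apply_le hd 1 h₁ y

/-- Hahn–Banach: a functional dominated by `r` that attains it at `u`. -/
theorem exists_linearMap_eq_seminorm {𝕜 E : Type*} [RCLike 𝕜] [AddCommGroup E] [Module 𝕜 E]
    (r : Seminorm 𝕜 E) (u : E) : ∃ g : E →ₗ[𝕜] 𝕜, (∀ v, ‖g v‖ ≤ r v) ∧ g u = (r u : 𝕜) := by
  let _ : SeminormedAddCommGroup E := r.toSeminormedAddCommGroup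
  let _ : NormedSpace 𝕜 E := { norm_smul_le := fun a b => (map_smul_eq_mul r a b).le }
  obtain ⟨g, hg, hu⟩ := exists_dual_vector'' 𝕜 u
  exact ⟨g.toLinearMap, fun v => (g.le_of_opNorm_le hg v).trans (one_mul (r v)).le, hu⟩

variable {𝕜 E X : Type*} [RCLike 𝕜] [AddCommGroup E] [Module 𝕜 E] [AddCommGroup X] [Module 𝕜 X]

theorem exists_bilinear_extension_of_seminorm (p : Seminorm 𝕜 E) (q : Seminorm 𝕜 X)
    (f : E →ₗ[𝕜] X) (hf : ∀ x, q (f x) = p x) (hd : ∀ x, ∀ ε > 0, ∃ e, q (x - f e) < ε)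
    (b : E →ₗ[𝕜] E →ₗ[𝕜] 𝕜) (hb : ∀ x y, ‖b x y‖ ≤ p x * p y) :
    ∃ b' : X →ₗ[𝕜] X →ₗ[𝕜] 𝕜, (∀ x y, b' (f x) (f y) = b x y) ∧
      ∀ x y, ‖b' x y‖ ≤ q x * q y := by
  let _ : SeminormedAddCommGroup E := p.toSeminormedAddCommGroup
  let _ : NormedSpace 𝕜 E := { norm_smul_le := fun a b => (map_smul_eq_mul p a b).le }
  let _ : SeminormedAddCommGroup X := q.toSeminormedAddCommGroup
  let _ : NormedSpace 𝕜 X := { norm_smul_le := fun a b => (map_smul_eq_mul q a b).le }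
  refine exists_bilinear_extension f hf (Metric.denseRange_iff.2 fun x ε hε => ?_) b hb
  obtain ⟨e, he⟩ := hd x ε hε
  exact ⟨e, by rw [dist_eq_norm]; exact he⟩

/-- The projective tensor seminorm of a space is the restriction of that of any space containing
it as a dense subspace. -/
theorem projectiveTensorSeminorm_map_eq (p : Seminorm 𝕜 E) (q : Seminorm 𝕜 X) (f : E →ₗ[𝕜] X)
    (hf : ∀ x, q (f x) = p x) (hd : ∀ x, ∀ ε > 0, ∃ e, q (x - f e) < ε) (u : E ⊗[𝕜] E) :
    projectiveTensorSeminorm q q (TensorProduct.map f f u) = projectiveTensorSeminorm p p u := by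
  apply le_antisymm
  · refine (bound_of_bound_tmul p p (projectiveTensorSeminorm q q) (TensorProduct.map f f)
      zero_le_one (fun a b => ?_) u).trans (one_mul _).le
    simpa [hf] using projectiveTensorSeminorm_le q q [(f a, f b)]
  -- Duality: a functional norming `u` is a bilinear form bounded by `p ⊗ p`. Its extension to `X`
  -- is bounded by `q ⊗ q` and takes the same value at the image of `u`.
  · obtain ⟨g, hg, hu⟩ := exists_linearMap_eq_seminorm (projectiveTensorSeminorm p p) u
    obtain ⟨b, hb, hb'⟩ := exists_bilinear_extension_of_seminorm p q f hf hd
      (TensorProduct.curry g) fun x y =>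
        (hg _).trans (by simpa using projectiveTensorSeminorm_le p p [(x, y)])
    have key : TensorProduct.lift b ∘ₗ TensorProduct.map f f = g :=
      TensorProduct.ext' fun x y => by simpa using hb x y
    have := bound_of_bound_tmul q q (normSeminorm 𝕜 𝕜) (TensorProduct.lift b) zero_le_one
      (fun x y => by simpa using hb' x y) (TensorProduct.map f f u)
    rw [one_mul, coe_normSeminorm, ← LinearMap.comp_apply, key, hu, RCLike.norm_ofReal,
      abs_of_nonneg (apply_nonneg _ _)] at this
    exact this

theorem exists_projectiveTensorSeminorm_sub_map_lt (q : Seminorm 𝕜 X) (f : E →ₗ[𝕜] X)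
    (hd : ∀ x, ∀ ε > 0, ∃ e, q (x - f e) < ε) (v : X ⊗[𝕜] X) :
    ∀ ε > 0, ∃ u, projectiveTensorSeminorm q q (v - TensorProduct.map f f u) < ε := by
  have htmul : ∀ x y, projectiveTensorSeminorm q q (x ⊗ₜ[𝕜] y) ≤ q x * q y := fun x y => by
    simpa using projectiveTensorSeminorm_le q q [(x, y)]
  induction v using TensorProduct.induction_on with
  | zero => exact fun ε hε => ⟨0, by simpa using hε⟩
  | tmul x y =>
    intro ε hε
    have hy : 0 < q y + 1 := add_pos_of_nonneg_of_pos (apply_nonneg _ _) one_pos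
    -- The error splits as `(x - f a) ⊗ y + f a ⊗ (y - f b)`, so `b` is chosen after `a`, with a
    -- tolerance depending on `q (f a)`. The `+ 1` keeps the denominators positive.
    obtain ⟨a, ha⟩ := hd x (ε / 2 / (q y + 1)) (by positivity)
    have hfa : 0 < q (f a) + 1 := add_pos_of_nonneg_of_pos (apply_nonneg _ _) one_pos
    obtain ⟨b, hb⟩ := hd y (ε / 2 / (q (f a) + 1)) (by positivity)
    refine ⟨a ⊗ₜ b, ?_⟩
    have : x ⊗ₜ[𝕜] y - TensorProduct.map f f (a ⊗ₜ b) =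
        (x - f a) ⊗ₜ y + f a ⊗ₜ (y - f b) := by
      rw [TensorProduct.map_tmul, TensorProduct.sub_tmul, TensorProduct.tmul_sub]; abel
    rw [this]
    rw [lt_div_iff₀ hy] at ha
    rw [lt_div_iff₀ hfa] at hb
    refine (map_add_le_add _ _ _).trans_lt ?_
    have h1 := htmul (x - f a) y
    have h2 := htmul (f a) (y - f b)
    have h3 : 0 ≤ q (x - f a) := apply_nonneg _ _
    have h4 : 0 ≤ q (y - f b) := apply_nonneg _ _
    linarith
  | add v w hv hw =>
    intro ε hε
    obtain ⟨a, ha⟩ := hv (ε / 2) (half_pos hε)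
    obtain ⟨b, hb⟩ := hw (ε / 2) (half_pos hε)
    refine ⟨a + b, ?_⟩
    rw [map_add, add_sub_add_comm]
    exact (map_add_le_add _ _ _).trans_lt (by linarith)

end DenseIsometry

/-! ### Maps between completed projective tensor products -/

namespace CompletedProjTensor

variable {𝕜 E F X : Type*} [RCLike 𝕜] [AddCommGroup E] [Module 𝕜 E] [AddCommGroup F] [Module 𝕜 F]
  [AddCommGroup X] [Module 𝕜 X]

section

variable (p : ℕ → Seminorm 𝕜 E) (q : ℕ → Seminorm 𝕜 F)

/-- The canonical map from the algebraic to the completed tensor product. -/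
def ofTensor (u : E ⊗[𝕜] F) : CompletedProjTensor p q :=
  UniformSpace.Completion.coe' (α := ProjTensor p q) u

theorem ofTensor_sub (u v : E ⊗[𝕜] F) : ofTensor p q (u - v) = ofTensor p q u - ofTensor p q v :=
  UniformSpace.Completion.coe_sub (α := ProjTensor p q) u v

theorem denseRange_ofTensor : DenseRange (ofTensor p q) :=
  UniformSpace.Completion.denseRange_coe (α := ProjTensor p q)

theorem continuous_seminorm (n : ℕ) : Continuous (seminorm p q n) :=
  UniformSpace.Completion.continuous_extension

theorem seminorm_ofTensor (n : ℕ) (u : E ⊗[𝕜] F) :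
    seminorm p q n (ofTensor p q u) = projectiveTensorSeminorm (p n) (q n) u :=
  UniformSpace.Completion.extension_coe (Seminorm.uniformContinuous_of_continuousAt_zero
    ((ProjTensor.withSeminorms p q).continuous_seminorm n).continuousAt) _

theorem map_ofTensor (f : E →ₗ[𝕜] E) (g : F →ₗ[𝕜] F)
    (hf : ∀ n, ∃ c : ℝ, 0 ≤ c ∧ ∀ x, p n (f x) ≤ c * p n x)
    (hg : ∀ n, ∃ c : ℝ, 0 ≤ c ∧ ∀ y, q n (g y) ≤ c * q n y) (u : E ⊗[𝕜] F) :
    map p q f g hf hg (ofTensor p q u) = ofTensor p q (TensorProduct.map f g u) :=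
  ContinuousLinearMap.completion_apply_coe (α := ProjTensor p q) (β := ProjTensor p q) _ _

theorem seminorm_map_le (f : E →ₗ[𝕜] E) (g : F →ₗ[𝕜] F)
    (hf : ∀ n, ∃ c : ℝ, 0 ≤ c ∧ ∀ x, p n (f x) ≤ c * p n x)
    (hg : ∀ n, ∃ c : ℝ, 0 ≤ c ∧ ∀ y, q n (g y) ≤ c * q n y) (n : ℕ) {c d : ℝ} (hc : 0 ≤ c)
    (hd : 0 ≤ d) (hfc : ∀ x, p n (f x) ≤ c * p n x) (hgd : ∀ y, q n (g y) ≤ d * q n y)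
    (z : CompletedProjTensor p q) :
    seminorm p q n (map p q f g hf hg z) ≤ c * d * seminorm p q n z := by
  refine (denseRange_ofTensor p q).induction_on z
    (isClosed_le ((continuous_seminorm p q n).comp (map p q f g hf hg).continuous)
      (continuous_const.mul (continuous_seminorm p q n))) fun u => ?_
  rw [map_ofTensor, seminorm_ofTensor, seminorm_ofTensor]
  refine bound_of_bound_tmul (p n) (q n) (projectiveTensorSeminorm (p n) (q n))
    (TensorProduct.map f g) (mul_nonneg hc hd) (fun a b => ?_) u
  refine (by simpa using projectiveTensorSeminorm_le (p n) (q n) [(f a, g b)] :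
    projectiveTensorSeminorm (p n) (q n) (f a ⊗ₜ[𝕜] g b) ≤ p n (f a) * q n (g b)).trans ?_
  calc p n (f a) * q n (g b) ≤ (c * p n a) * (d * q n b) :=
        mul_le_mul (hfc a) (hgd b) (apply_nonneg _ _) (mul_nonneg hc (apply_nonneg _ _))
    _ = c * d * (p n a * q n b) := by ring

/-- The extended seminorms define the topology of the completion: a closed neighbourhood of `0`
contains a basic ball of the dense subspace. The corresponding open ball of the completion lies in
the closure of its trace on that subspace, hence in the neighbourhood. -/
theorem tendsto_zero_of_seminorm {ι : Type*} {l : Filter ι} {z : ι → CompletedProjTensor p q}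
    (h : ∀ n, Tendsto (fun i => seminorm p q n (z i)) l (𝓝 0)) : Tendsto z l (𝓝 0) := by
  intro U hU
  obtain ⟨V, hV, hVc, hVU⟩ := exists_mem_nhds_isClosed_subset hU
  have hV' : {u : ProjTensor p q | UniformSpace.Completion.coe' u ∈ V} ∈ 𝓝 0 :=
    (UniformSpace.Completion.continuous_coe (ProjTensor p q)).tendsto' 0 0
      UniformSpace.Completion.coe_zero hV
  obtain ⟨⟨s, r⟩, hr, hs⟩ := (ProjTensor.withSeminorms p q).hasBasis_zero_ball.mem_iff.1 hV'
  have hO : IsOpen {w | ∀ n ∈ s, seminorm p q n w < r} := by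
    simp only [ofPred_forall]
    exact isOpen_biInter_finset fun n _ =>
      isOpen_lt (continuous_seminorm p q n) continuous_const
  have hOV : {w | ∀ n ∈ s, seminorm p q n w < r} ⊆ V := by
    refine ((denseRange_ofTensor p q).open_subset_closure_inter hO).trans
      (closure_minimal ?_ hVc)
    rintro _ ⟨hw, u, rfl⟩
    refine hs ((Seminorm.mem_ball_zero _).2 (Seminorm.finset_sup_apply_lt hr fun n hn => ?_))
    exact (seminorm_ofTensor p q n u).symm.trans_lt (hw n hn)
  have hev : ∀ᶠ i in l, ∀ n ∈ s, seminorm p q n (z i) < r :=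
    (Filter.eventually_all_finset s).2 fun n _ => (h n).eventually_lt_const hr
  exact hev.mono fun i hi => hVU (hOV hi)

end

section

variable (p : ℕ → Seminorm 𝕜 E) (q : ℕ → Seminorm 𝕜 X)

/-- The map `f ⊗̂ f` given by a linear map `f` that is continuous for the given seminorms. -/
def mapSquare (f : E →ₗ[𝕜] X) (hf : ∀ m, ∃ n, ∃ c : ℝ, 0 ≤ c ∧ ∀ x, q m (f x) ≤ c * p n x) :
    CompletedProjTensor p p →L[𝕜] CompletedProjTensor q q :=
  ContinuousLinearMap.completion (α := ProjTensor p p) (β := ProjTensor q q)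
    { toLinearMap := (TensorProduct.map f f : E ⊗[𝕜] E →ₗ[𝕜] X ⊗[𝕜] X)
      cont := by
        refine WithSeminorms.continuous_of_isBounded (ProjTensor.withSeminorms p p)
          (ProjTensor.withSeminorms q q) _ ?_
        refine Seminorm.IsBounded.of_real fun m => ?_
        obtain ⟨n, c, hc, hcf⟩ := hf m
        refine ⟨{n}, c * c, fun u => ?_⟩
        rw [Finset.sup_singleton]
        refine bound_of_bound_tmul (p n) (p n) (projectiveTensorSeminorm (q m) (q m)) _
          (mul_nonneg hc hc) (fun a b => ?_) u
        rw [TensorProduct.map_tmul]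
        refine (by simpa using projectiveTensorSeminorm_le (q m) (q m) [(f a, f b)] :
          projectiveTensorSeminorm (q m) (q m) (f a ⊗ₜ[𝕜] f b) ≤ q m (f a) * q m (f b)).trans ?_
        calc q m (f a) * q m (f b) ≤ (c * p n a) * (c * p n b) :=
              mul_le_mul (hcf a) (hcf b) (apply_nonneg _ _)
                (mul_nonneg hc (apply_nonneg _ _))
          _ = c * c * (p n a * p n b) := by ring }

variable (f : E →ₗ[𝕜] X) (hf : ∀ m, ∃ n, ∃ c : ℝ, 0 ≤ c ∧ ∀ x, q m (f x) ≤ c * p n x)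

theorem mapSquare_ofTensor (u : E ⊗[𝕜] E) :
    mapSquare p q f hf (ofTensor p p u) = ofTensor q q (TensorProduct.map f f u) :=
  ContinuousLinearMap.completion_apply_coe (α := ProjTensor p p) (β := ProjTensor q q) _ _

theorem seminorm_mapSquare_le {m n : ℕ} {c : ℝ} (hc : 0 ≤ c) (hfc : ∀ x, q m (f x) ≤ c * p n x)
    (z : CompletedProjTensor p p) :
    seminorm q q m (mapSquare p q f hf z) ≤ c * c * seminorm p p n z := by
  refine (denseRange_ofTensor p p).induction_on z
    (isClosed_le ((continuous_seminorm q q m).comp (mapSquare p q f hf).continuous)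
      (continuous_const.mul (continuous_seminorm p p n))) fun u => ?_
  rw [mapSquare_ofTensor, seminorm_ofTensor, seminorm_ofTensor]
  refine bound_of_bound_tmul (p n) (p n) (projectiveTensorSeminorm (q m) (q m))
    (TensorProduct.map f f) (mul_nonneg hc hc) (fun a b => ?_) u
  refine (by simpa using projectiveTensorSeminorm_le (q m) (q m) [(f a, f b)] :
    projectiveTensorSeminorm (q m) (q m) (f a ⊗ₜ[𝕜] f b) ≤ q m (f a) * q m (f b)).trans ?_
  calc q m (f a) * q m (f b) ≤ (c * p n a) * (c * p n b) :=
        mul_le_mul (hfc a) (hfc b) (apply_nonneg _ _) (mul_nonneg hc (apply_nonneg _ _))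
    _ = c * c * (p n a * p n b) := by ring

theorem seminorm_mapSquare_eq {m n : ℕ} (hfp : ∀ x, q m (f x) = p n x)
    (hd : ∀ x, ∀ ε > 0, ∃ e, q m (x - f e) < ε) (z : CompletedProjTensor p p) :
    seminorm q q m (mapSquare p q f hf z) = seminorm p p n z := by
  refine (denseRange_ofTensor p p).induction_on z
    (isClosed_eq ((continuous_seminorm q q m).comp (mapSquare p q f hf).continuous)
      (continuous_seminorm p p n)) fun u => ?_
  rw [mapSquare_ofTensor, seminorm_ofTensor, seminorm_ofTensor]
  exact projectiveTensorSeminorm_map_eq _ _ f hfp hd u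

theorem exists_seminorm_sub_mapSquare_lt {m : ℕ} (hd : ∀ x, ∀ ε > 0, ∃ e, q m (x - f e) < ε)
    (z : CompletedProjTensor q q) {ε : ℝ} (hε : 0 < ε) :
    ∃ w, seminorm q q m (z - mapSquare p q f hf w) < ε := by
  have hopen : IsOpen {v | seminorm q q m (z - v) < ε / 2} :=
    isOpen_lt ((continuous_seminorm q q m).comp (continuous_const.sub continuous_id))
      continuous_const
  obtain ⟨v, hv⟩ := (denseRange_ofTensor q q).exists_mem_open hopen ⟨z, by simpa using hε⟩
  obtain ⟨u, hu⟩ := exists_projectiveTensorSeminorm_sub_map_lt (q m) f hd v (ε / 2) (half_pos hε)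
  refine ⟨ofTensor p p u, ?_⟩
  rw [← seminorm_ofTensor q q, ofTensor_sub] at hu
  rw [mapSquare_ofTensor, ← sub_add_sub_cancel z (ofTensor q q v)]
  exact (map_add_le_add _ _ _).trans_lt (by linarith [hv.out])

end

end CompletedProjTensor

/-! ### The Banach algebra given by a submultiplicative seminorm -/

section BanachCompletion

open UniformSpace.Completion in
/-- The completion of a non-unital seminormed ring is a non-unital Banach ring. -/
@[reducible]
def nonUnitalNormedRingCompletion (R : Type*) [NonUnitalSeminormedRing R] :
    NonUnitalNormedRing (UniformSpace.Completion R) := by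
  let m : R →+ R →+ UniformSpace.Completion R := AddMonoidHom.mul.compr₂ toCompl
  have di : IsDenseInducing (toCompl : R → UniformSpace.Completion R) := isDenseInducing_coe
  have hm : Continuous fun p : R × R => m p.1 p.2 := (continuous_coe R).comp continuous_mul
  -- The product is the extension by continuity of the product of `R`; the algebraic identities and
  -- the norm inequality then pass from `R` by density.
  let _ : Mul (UniformSpace.Completion R) := ⟨fun x y => (di.prodMap di).extend
    (fun p : R × R => m p.1 p.2) (x, y)⟩
  have coe_mul' (a b : R) : ((a * b : R) : UniformSpace.Completion R) = a * b :=
    ((di.prodMap di).extend_eq hm (a, b)).symm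
  have : ContinuousMul (UniformSpace.Completion R) := ⟨di.extend_Z_bilin di hm⟩
  exact
  { (inferInstance : NormedAddCommGroup (UniformSpace.Completion R)),
    (inferInstance : Mul (UniformSpace.Completion R)) with
    zero_mul a := by
      induction a using induction_on with
      | hp => exact isClosed_eq (by fun_prop) continuous_const
      | ih a => rw [← coe_zero, ← coe_mul', zero_mul]
    mul_zero a := by
      induction a using induction_on with
      | hp => exact isClosed_eq (by fun_prop) continuous_const
      | ih a => rw [← coe_zero, ← coe_mul', mul_zero]
    mul_assoc a b c := by
      induction a, b, c using induction_on₃ with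
      | hp => exact isClosed_eq (by fun_prop) (by fun_prop)
      | ih a b c => rw [← coe_mul', ← coe_mul', ← coe_mul', ← coe_mul', mul_assoc]
    left_distrib a b c := by
      induction a, b, c using induction_on₃ with
      | hp => exact isClosed_eq (by fun_prop) (by fun_prop)
      | ih a b c => rw [← coe_add, ← coe_mul', ← coe_mul', ← coe_mul', ← coe_add, mul_add]
    right_distrib a b c := by
      induction a, b, c using induction_on₃ with
      | hp => exact isClosed_eq (by fun_prop) (by fun_prop)
      | ih a b c => rw [← coe_add, ← coe_mul', ← coe_mul', ← coe_mul', ← coe_add, add_mul]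
    norm_mul_le x y := by
      induction x, y using induction_on₂ with
      | hp => exact isClosed_le (by fun_prop) (by fun_prop)
      | ih x y => simpa only [← coe_mul', norm_coe] using norm_mul_le x y }

section

variable {𝕜 R B : Type*} [RCLike 𝕜] [NonUnitalSeminormedRing R] [NormedSpace 𝕜 R]
  [NonUnitalNormedRing B] [NormedSpace 𝕜 B] {φ : R → B}

theorem isScalarTower_of_denseRange [IsScalarTower 𝕜 R R] (hd : DenseRange φ)
    (hmul : ∀ a b, φ (a * b) = φ a * φ b) (hsmul : ∀ (c : 𝕜) a, φ (c • a) = c • φ a) :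
    IsScalarTower 𝕜 B B :=
  ⟨fun c x y => hd.induction_on₂ (p := fun x y => c • x * y = c • (x * y))
    (isClosed_eq (by fun_prop) (by fun_prop))
    (fun x y => by rw [← hsmul, ← hmul, ← hmul, ← hsmul, smul_mul_assoc]) x y⟩

theorem smulCommClass_of_denseRange [SMulCommClass 𝕜 R R] (hd : DenseRange φ)
    (hmul : ∀ a b, φ (a * b) = φ a * φ b) (hsmul : ∀ (c : 𝕜) a, φ (c • a) = c • φ a) :
    SMulCommClass 𝕜 B B :=
  ⟨fun c x y => hd.induction_on₂ (p := fun x y => c • (x * y) = x * c • y)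
    (isClosed_eq (by fun_prop) (by fun_prop))
    (fun x y => by rw [← hsmul, ← hmul, ← hmul, ← hsmul, mul_smul_comm]) x y⟩

end

theorem exists_banach_completion (𝕜 : Type*) (R : Type u) [RCLike 𝕜] [NonUnitalSeminormedRing R]
    [NormedSpace 𝕜 R] [IsScalarTower 𝕜 R R] [SMulCommClass 𝕜 R R] :
    ∃ (B : Type u) (_ : NonUnitalNormedRing B) (_ : NormedSpace 𝕜 B) (_ : IsScalarTower 𝕜 B B)
      (_ : SMulCommClass 𝕜 B B) (_ : CompleteSpace B) (φ : R →ₙₐ[𝕜] B),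
      DenseRange φ ∧ ∀ a, ‖φ a‖ = ‖a‖ := by
  let iB := nonUnitalNormedRingCompletion R
  let iN : @NormedSpace 𝕜 (UniformSpace.Completion R) _
      iB.toNonUnitalSeminormedRing.toSeminormedAddCommGroup :=
    (inferInstance : NormedSpace 𝕜 (UniformSpace.Completion R))
  have hmul (a b : R) : ((a * b : R) : UniformSpace.Completion R) = a * b :=
    ((UniformSpace.Completion.isDenseInducing_coe.prodMap
      UniformSpace.Completion.isDenseInducing_coe).extend_eq
      ((UniformSpace.Completion.continuous_coe R).comp continuous_mul) (a, b)).symm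
  have hsmul (c : 𝕜) (a : R) : ((c • a : R) : UniformSpace.Completion R) = c • a :=
    UniformSpace.Completion.coe_smul c a
  exact ⟨UniformSpace.Completion R, iB, iN,
    isScalarTower_of_denseRange UniformSpace.Completion.denseRange_coe hmul hsmul,
    smulCommClass_of_denseRange UniformSpace.Completion.denseRange_coe hmul hsmul,
    inferInstanceAs (CompleteSpace (UniformSpace.Completion R)),
    { toFun := fun a => (a : UniformSpace.Completion R)
      map_smul' := hsmul
      map_zero' := UniformSpace.Completion.coe_zero
      map_add' := UniformSpace.Completion.coe_add
      map_mul' := hmul },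
    UniformSpace.Completion.denseRange_coe, fun a => UniformSpace.Completion.norm_coe a⟩

/-- The seminorm need not be definite: the Hausdorff completion also divides by its kernel, so `φ`
need not be injective. -/
theorem exists_banach_completion_of_seminorm {𝕜 : Type*} {A : Type u} [RCLike 𝕜]
    [NonUnitalRing A] [Module 𝕜 A] [IsScalarTower 𝕜 A A] [SMulCommClass 𝕜 A A] (p : Seminorm 𝕜 A)
    (hp : ∀ a b, p (a * b) ≤ p a * p b) :
    ∃ (B : Type u) (_ : NonUnitalNormedRing B) (_ : NormedSpace 𝕜 B) (_ : IsScalarTower 𝕜 B B)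
      (_ : SMulCommClass 𝕜 B B) (_ : CompleteSpace B) (φ : A →ₙₐ[𝕜] B),
      DenseRange φ ∧ ∀ a, ‖φ a‖ = p a := by
  let _ : NonUnitalSeminormedRing A :=
    { p.toSeminormedAddCommGroup, ‹NonUnitalRing A› with norm_mul_le := hp }
  let _ : NormedSpace 𝕜 A := { norm_smul_le := fun a b => (map_smul_eq_mul p a b).le }
  exact exists_banach_completion 𝕜 A

end BanachCompletion

/-! ### Estimates for the bimodule `A / I ⊗̂ A / I` -/

section Bimodule

variable {𝕜 A : Type*} [RCLike 𝕜] [NonUnitalRing A] [Module 𝕜 A] [IsScalarTower 𝕜 A A]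
  [SMulCommClass 𝕜 A A]

namespace ClosedIdeal

variable [TopologicalSpace A] (I : ClosedIdeal 𝕜 A)

theorem lmul_of_mem {a : A} (ha : a ∈ I.toSubmodule) : I.lmul a = 0 := by
  ext x
  exact (Submodule.Quotient.mk_eq_zero _).2 (I.mul_mem_right x a ha)

theorem rmul_of_mem {a : A} (ha : a ∈ I.toSubmodule) : I.rmul a = 0 := by
  ext x
  exact (Submodule.Quotient.mk_eq_zero _).2 (I.mul_mem_left x a ha)

theorem lmul_sub (a b : A) : I.lmul (a - b) = I.lmul a - I.lmul b := by
  ext x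
  exact congrArg I.proj (sub_mul a b x)

theorem rmul_sub (a b : A) : I.rmul (a - b) = I.rmul a - I.rmul b := by
  ext x
  exact congrArg I.proj (mul_sub x a b)

end ClosedIdeal

namespace FrechetSeminorms

open CompletedProjTensor

section

variable [TopologicalSpace A] (S : FrechetSeminorms 𝕜 A) (I : ClosedIdeal 𝕜 A)

theorem lact_ofTensor (a : A) (u : I.Quot ⊗[𝕜] I.Quot) :
    S.lact I a (ofTensor _ _ u) = ofTensor _ _ (TensorProduct.map (I.lmul a) LinearMap.id u) :=
  map_ofTensor _ _ _ _ _ _ u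

theorem ract_ofTensor (a : A) (u : I.Quot ⊗[𝕜] I.Quot) :
    S.ract I a (ofTensor _ _ u) = ofTensor _ _ (TensorProduct.map LinearMap.id (I.rmul a) u) :=
  map_ofTensor _ _ _ _ _ _ u

theorem rHat_lact_le (n : ℕ) (a : A) (z : S.QuotTensor I) :
    S.rHat I n (S.lact I a z) ≤ S.p n a * S.rHat I n z := by
  simpa only [mul_one] using! seminorm_map_le (S.pHat I) (S.pHat I) (I.lmul a) LinearMap.id _ _ n
    (apply_nonneg _ _) zero_le_one (S.pHat_lmul_le I n a) (fun y => (one_mul _).ge) z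

theorem rHat_ract_le (n : ℕ) (a : A) (z : S.QuotTensor I) :
    S.rHat I n (S.ract I a z) ≤ S.p n a * S.rHat I n z := by
  simpa only [one_mul] using! seminorm_map_le (S.pHat I) (S.pHat I) LinearMap.id (I.rmul a) _ _ n
    zero_le_one (apply_nonneg _ _) (fun y => (one_mul _).ge) (S.pHat_rmul_le I n a) z

/-- The commutator `a · z - z · a`. -/
def commutator (a : A) : S.QuotTensor I →L[𝕜] S.QuotTensor I := S.lact I a - S.ract I a

theorem commutator_apply (a : A) (z : S.QuotTensor I) :
    S.commutator I a z = S.lact I a z - S.ract I a z := rfl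

/-- Both actions of `I` on `A / I` are zero. This makes the restriction to `a ∉ I` in the
definitions harmless. -/
theorem commutator_of_mem {a : A} (ha : a ∈ I.toSubmodule) (z : S.QuotTensor I) :
    S.commutator I a z = 0 := by
  refine (denseRange_ofTensor _ _).induction_on z
    (isClosed_eq (S.commutator I a).continuous continuous_const) fun u => ?_
  rw [commutator_apply, lact_ofTensor, ract_ofTensor, I.lmul_of_mem ha, I.rmul_of_mem ha]
  simp

theorem commutator_sub_left (a b : A) (z : S.QuotTensor I) :
    S.commutator I (a - b) z = S.commutator I a z - S.commutator I b z := by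
  refine (denseRange_ofTensor _ _).induction_on z (isClosed_eq (S.commutator I _).continuous
    ((S.commutator I a).continuous.sub (S.commutator I b).continuous)) fun u => ?_
  simp only [commutator_apply, lact_ofTensor, ract_ofTensor, I.lmul_sub, I.rmul_sub,
    ← ofTensor_sub]
  congr 1
  induction u using TensorProduct.induction_on with
  | zero => simp
  | tmul x y => simp [TensorProduct.sub_tmul, TensorProduct.tmul_sub]; abel
  | add u v hu hv => simp only [map_add, add_sub_add_comm, hu, hv]

theorem rHat_commutator_le (n : ℕ) (a : A) (z : S.QuotTensor I) :
    S.rHat I n (S.commutator I a z) ≤ 2 * (S.p n a * S.rHat I n z) :=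
  (map_sub_le_add _ _ _).trans
    ((add_le_add (S.rHat_lact_le I n a z) (S.rHat_ract_le I n a z)).trans (two_mul _).ge)

end

variable [UniformSpace A] [IsUniformAddGroup A] [CompleteSpace A] (S : FrechetSeminorms 𝕜 A) (I : ClosedIdeal 𝕜 A)

theorem diagonalMap_ofTensor (u : I.Quot ⊗[𝕜] I.Quot) :
    S.diagonalMap I (ofTensor _ _ u) = TensorProduct.lift I.mulQuot u := by
  have : FirstCountableTopology A := S.withSeminorms.firstCountableTopology
  have : ContinuousSMul 𝕜 A := S.withSeminorms.continuousSMul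
  have : IsClosed (I.toSubmodule : Set A) := I.isClosed
  let _ : UniformSpace I.Quot := IsTopologicalAddGroup.rightUniformSpace _
  have : IsUniformAddGroup I.Quot := isUniformAddGroup_of_addCommGroup
  have : CompleteSpace I.Quot := QuotientAddGroup.completeSpace_right A I.toSubmodule.toAddSubgroup
  have : ContinuousSMul 𝕜 I.Quot := (S.withSeminorms_pHat I).continuousSMul
  have : UniformContinuousConstSMul 𝕜 I.Quot :=
    uniformContinuousConstSMul_of_continuousConstSMul 𝕜 _
  exact ContinuousLinearMap.fromCompletion_apply_coe
    (α := ProjTensor (S.pHat I) (S.pHat I)) (β := I.Quot) _ u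

theorem pHat_diagonalMap_le (n : ℕ) (z : S.QuotTensor I) :
    S.pHat I n (S.diagonalMap I z) ≤ S.rHat I n z := by
  refine (denseRange_ofTensor _ _).induction_on z (isClosed_le
    (((S.withSeminorms_pHat I).continuous_seminorm n).comp (S.diagonalMap I).continuous)
    (continuous_seminorm _ _ n)) fun u => ?_
  rw [diagonalMap_ofTensor, seminorm_ofTensor]
  refine (bound_of_bound_tmul (S.pHat I n) (S.pHat I n) (S.pHat I n)
    (TensorProduct.lift I.mulQuot) zero_le_one
    (fun x y => by simpa using S.pHat_mulQuot_le I n x y) u).trans (one_mul _).le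

/-- The defect `a · π (z) - ã`. -/
def unitDefect (a : A) (z : S.QuotTensor I) : I.Quot := I.lmul a (S.diagonalMap I z) - I.proj a

theorem unitDefect_sub_left (a b : A) (z : S.QuotTensor I) :
    S.unitDefect I (a - b) z = S.unitDefect I a z - S.unitDefect I b z := by
  simp only [unitDefect, I.lmul_sub, LinearMap.sub_apply, map_sub]
  abel

/-- The defect is affine in the tensor, so the term `ã` cancels from the correction. -/
theorem unitDefect_sub_right (a : A) (z w : S.QuotTensor I) :
    S.unitDefect I a w = S.unitDefect I a z - I.lmul a (S.diagonalMap I (z - w)) := by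
  simp only [unitDefect, map_sub]
  abel

theorem pHat_lmul_diagonalMap_le (n : ℕ) (a : A) (z : S.QuotTensor I) :
    S.pHat I n (I.lmul a (S.diagonalMap I z)) ≤ S.p n a * S.rHat I n z :=
  (S.pHat_lmul_le I n a _).trans
    (mul_le_mul_of_nonneg_left (S.pHat_diagonalMap_le I n z) (apply_nonneg _ _))

theorem pHat_unitDefect_le (n : ℕ) (a : A) (z : S.QuotTensor I) :
    S.pHat I n (S.unitDefect I a z) ≤ S.p n a * S.rHat I n z + S.p n a :=
  (map_sub_le_add _ _ _).trans
    (add_le_add (S.pHat_lmul_diagonalMap_le I n a z) (quotientSeminorm_mk_le _ _ _))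

end FrechetSeminorms

end Bimodule

/-! ### Homomorphisms -/

section Homomorphism

variable {𝕜 A B : Type*} [RCLike 𝕜] [NonUnitalRing A] [Module 𝕜 A] [IsScalarTower 𝕜 A A]
  [SMulCommClass 𝕜 A A] [NonUnitalRing B] [Module 𝕜 B] [IsScalarTower 𝕜 B B]
  [SMulCommClass 𝕜 B B]

open CompletedProjTensor

namespace ClosedIdeal

variable [TopologicalSpace A] [TopologicalSpace B] (I : ClosedIdeal 𝕜 A) (J : ClosedIdeal 𝕜 B)
  (φ : A →ₙₐ[𝕜] B) (h : ∀ x ∈ I.toSubmodule, φ x ∈ J.toSubmodule)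

/-- The linear map `A / I → B / J` induced by a homomorphism `φ` with `φ(I) ⊆ J`. -/
def quotMap : I.Quot →ₗ[𝕜] J.Quot :=
  I.toSubmodule.mapQ J.toSubmodule (φ : A →ₗ[𝕜] B) h

theorem quotMap_proj (a : A) : I.quotMap J φ h (I.proj a) = J.proj (φ a) := rfl

theorem quotMap_lmul (a : A) (x : I.Quot) :
    I.quotMap J φ h (I.lmul a x) = J.lmul (φ a) (I.quotMap J φ h x) := by
  obtain ⟨b, rfl⟩ := I.toSubmodule.mkQ_surjective x
  exact congrArg J.proj (map_mul φ a b)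

theorem quotMap_rmul (a : A) (x : I.Quot) :
    I.quotMap J φ h (I.rmul a x) = J.rmul (φ a) (I.quotMap J φ h x) := by
  obtain ⟨b, rfl⟩ := I.toSubmodule.mkQ_surjective x
  exact congrArg J.proj (map_mul φ b a)

theorem quotMap_mulQuot (x y : I.Quot) :
    I.quotMap J φ h (I.mulQuot x y) = J.mulQuot (I.quotMap J φ h x) (I.quotMap J φ h y) := by
  obtain ⟨a, rfl⟩ := I.toSubmodule.mkQ_surjective x
  exact I.quotMap_lmul J φ h a y

theorem continuous_quotMap (hφ : Continuous φ) : Continuous (I.quotMap J φ h) :=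
  continuous_quot_lift _ (continuous_quot_mk.comp hφ)

end ClosedIdeal

namespace FrechetSeminorms

section

variable [TopologicalSpace A] [TopologicalSpace B] (S : FrechetSeminorms 𝕜 A)
  (T : FrechetSeminorms 𝕜 B) (I : ClosedIdeal 𝕜 A) (J : ClosedIdeal 𝕜 B)
  (φ : A →ₙₐ[𝕜] B) (h : ∀ x ∈ I.toSubmodule, φ x ∈ J.toSubmodule)

theorem pHat_quotMap_le {m n : ℕ} {c : ℝ} (hc : 0 < c) (hφ : ∀ a, T.p m (φ a) ≤ c * S.p n a)
    (x : I.Quot) : T.pHat J m (I.quotMap J φ h x) ≤ c * S.pHat I n x := by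
  by_contra! hlt
  rw [← lt_div_iff₀' hc] at hlt
  obtain ⟨a, rfl, ha⟩ := exists_lt_of_quotientSeminorm_lt _ _ hlt
  rw [lt_div_iff₀' hc] at ha
  exact (((quotientSeminorm_mk_le (T.p m) J.toSubmodule (φ a)).trans (hφ a)).trans_lt ha).false

variable (hf : ∀ m, ∃ n, ∃ c : ℝ, 0 ≤ c ∧
  ∀ x, T.pHat J m (I.quotMap J φ h x) ≤ c * S.pHat I n x)

/-- The map `A / I ⊗̂ A / I → B / J ⊗̂ B / J` induced by `φ`. -/
def tensorMap : S.QuotTensor I →L[𝕜] T.QuotTensor J :=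
  mapSquare (S.pHat I) (T.pHat J) (I.quotMap J φ h) hf

theorem tensorMap_ofTensor (u : I.Quot ⊗[𝕜] I.Quot) :
    S.tensorMap T I J φ h hf (ofTensor _ _ u) =
      ofTensor _ _ (TensorProduct.map (I.quotMap J φ h) (I.quotMap J φ h) u) :=
  mapSquare_ofTensor _ _ _ hf u

theorem tensorMap_commutator (a : A) (z : S.QuotTensor I) :
    S.tensorMap T I J φ h hf (S.commutator I a z) =
      T.commutator J (φ a) (S.tensorMap T I J φ h hf z) := by
  refine (denseRange_ofTensor _ _).induction_on z (isClosed_eq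
    ((S.tensorMap T I J φ h hf).continuous.comp (S.commutator I a).continuous)
    ((T.commutator J (φ a)).continuous.comp (S.tensorMap T I J φ h hf).continuous)) fun u => ?_
  simp only [commutator_apply, map_sub, tensorMap_ofTensor, lact_ofTensor, ract_ofTensor]
  congr 2
  · induction u using TensorProduct.induction_on with
    | zero => simp
    | tmul x y => simp [ClosedIdeal.quotMap_lmul]
    | add u v hu hv => simp only [map_add, hu, hv]
  · induction u using TensorProduct.induction_on with
    | zero => simp
    | tmul x y => simp [ClosedIdeal.quotMap_rmul]
    | add u v hu hv => simp only [map_add, hu, hv]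

end

variable [UniformSpace A] [IsUniformAddGroup A] [CompleteSpace A]
  [UniformSpace B] [IsUniformAddGroup B] [CompleteSpace B] (S : FrechetSeminorms 𝕜 A)
  (T : FrechetSeminorms 𝕜 B) (I : ClosedIdeal 𝕜 A) (J : ClosedIdeal 𝕜 B)
  (φ : A →ₙₐ[𝕜] B) (h : ∀ x ∈ I.toSubmodule, φ x ∈ J.toSubmodule)
  (hf : ∀ m, ∃ n, ∃ c : ℝ, 0 ≤ c ∧
    ∀ x, T.pHat J m (I.quotMap J φ h x) ≤ c * S.pHat I n x)

theorem quotMap_diagonalMap (hφ : Continuous φ) (z : S.QuotTensor I) :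
    I.quotMap J φ h (S.diagonalMap I z) = T.diagonalMap J (S.tensorMap T I J φ h hf z) := by
  -- Closedness of `J` makes `B / J` Hausdorff, so that agreement on a dense set suffices.
  have : IsClosed (J.toSubmodule : Set B) := J.isClosed
  refine (denseRange_ofTensor _ _).induction_on z (isClosed_eq
    ((I.continuous_quotMap J φ h hφ).comp (S.diagonalMap I).continuous)
    ((T.diagonalMap J).continuous.comp (S.tensorMap T I J φ h hf).continuous)) fun u => ?_
  rw [tensorMap_ofTensor, diagonalMap_ofTensor, diagonalMap_ofTensor]
  induction u using TensorProduct.induction_on with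
  | zero => simp
  | tmul x y => simp [ClosedIdeal.quotMap_mulQuot]
  | add u v hu hv => simp only [map_add, hu, hv]

theorem quotMap_unitDefect (hφ : Continuous φ) (a : A) (z : S.QuotTensor I) :
    I.quotMap J φ h (S.unitDefect I a z) =
      T.unitDefect J (φ a) (S.tensorMap T I J φ h hf z) := by
  rw [unitDefect, map_sub, ClosedIdeal.quotMap_lmul, quotMap_diagonalMap S T I J φ h hf hφ,
    ClosedIdeal.quotMap_proj, unitDefect]

end FrechetSeminorms

end Homomorphism

/-! ### The two implications -/

namespace FrechetSeminorms

open CompletedProjTensor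

/-- A continuous linear map to a normed space is bounded by one of the seminorms. -/
theorem exists_norm_le {𝕜 A B : Type*} [RCLike 𝕜] [NonUnitalRing A] [Module 𝕜 A]
    [TopologicalSpace A] (S : FrechetSeminorms 𝕜 A) [SeminormedAddCommGroup B] [NormedSpace 𝕜 B]
    (f : A →ₗ[𝕜] B) (hf : Continuous f) : ∃ n, ∃ c : ℝ, 0 < c ∧ ∀ a, ‖f a‖ ≤ c * S.p n a := by
  obtain ⟨s, C, -, hC⟩ := Seminorm.bound_of_continuous S.withSeminorms
    ((normSeminorm 𝕜 B).comp f) (continuous_norm.comp hf)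
  obtain ⟨N, hN⟩ := s.exists_le
  -- Monotonicity replaces a finite supremum of the `p_i` by one `p_N`; the `+ 1` makes the constant
  -- strictly positive.
  refine ⟨N, C + 1, by positivity, fun a => ?_⟩
  have hs : s.sup S.p a ≤ S.p N a :=
    Seminorm.finset_sup_apply_le (apply_nonneg _ _) fun i hi => S.mono (hN i hi) a
  calc ‖f a‖ ≤ C * s.sup S.p a := hC a
    _ ≤ (C + 1) * S.p N a :=
      mul_le_mul (by simp) hs (apply_nonneg _ _) (by positivity)

section

variable {𝕜 : Type*} {B : Type u} [RCLike 𝕜] [NonUnitalNormedRing B] [NormedSpace 𝕜 B]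
  [IsScalarTower 𝕜 B B] [SMulCommClass 𝕜 B B] [CompleteSpace B]

/-- In a Banach algebra a bounded approximate diagonal is obtained from bounded approximate
solutions for finite sets. -/
theorem hasBoundedApproximateDiagonalMod_ofNorm (J : ClosedIdeal 𝕜 B) (R : ℝ)
    (h : ∀ F : Finset B, ∀ ε : ℝ, 0 < ε → ∃ m : (ofNorm 𝕜 B).QuotTensor J,
      (ofNorm 𝕜 B).rHat J 0 m ≤ R ∧
      ∀ b ∈ F, (ofNorm 𝕜 B).rHat J 0 ((ofNorm 𝕜 B).commutator J b m) < ε ∧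
        (ofNorm 𝕜 B).pHat J 0 ((ofNorm 𝕜 B).unitDefect J b m) < ε) :
    (ofNorm 𝕜 B).HasBoundedApproximateDiagonalMod J := by
  classical
  -- The net is indexed by a finite set and a tolerance `1 / (k + 1)`, in the product order. Index
  -- `0` stands for every seminorm, all of them being the norm.
  choose m hR hm using fun i : Finset B × ℕ => h i.1 (1 / (i.2 + 1 : ℝ)) Nat.one_div_pos_of_nat
  have hev : ∀ b : B, ∀ ε : ℝ, 0 < ε → ∀ᶠ i : Finset B × ℕ in atTop,
      b ∈ i.1 ∧ 1 / (i.2 + 1 : ℝ) < ε := fun b ε hε => by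
    obtain ⟨k, hk⟩ := exists_nat_one_div_lt hε
    filter_upwards [eventually_ge_atTop (({b}, k) : Finset B × ℕ)] with i hi
    exact ⟨hi.1 (Finset.mem_singleton_self b), (Nat.one_div_le_one_div hi.2).trans_lt hk⟩
  refine ⟨Finset B × ℕ, inferInstance, inferInstance, inferInstance, m, fun _ => ⟨R, hR⟩,
    fun b => ?_, fun b _ => ?_⟩
  · rw [((ofNorm 𝕜 B).withSeminorms_pHat J).tendsto_nhds]
    intro n ε hε
    filter_upwards [hev b ε hε] with i hi
    rw [sub_zero]
    exact (hm i b hi.1).2.trans hi.2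
  · refine tendsto_zero_of_seminorm _ _ fun n => ?_
    rw [Metric.tendsto_nhds]
    intro ε hε
    filter_upwards [hev b ε hε] with i hi
    rw [Real.dist_0_eq_abs, abs_of_nonneg (apply_nonneg _ _)]
    exact (hm i b hi.1).1.trans hi.2

end

variable {𝕜 : Type*} {A : Type u} [RCLike 𝕜] [NonUnitalRing A] [Module 𝕜 A]
  [IsScalarTower 𝕜 A A] [SMulCommClass 𝕜 A A] [UniformSpace A] [IsUniformAddGroup A]
  [CompleteSpace A] (S : FrechetSeminorms 𝕜 A) (I : ClosedIdeal 𝕜 A)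

variable {S I} in
theorem HasLocallyBoundedApproximateDiagonalMod.ofNorm_of_denseRange
    (hS : S.HasLocallyBoundedApproximateDiagonalMod I) {B : Type u} [NonUnitalNormedRing B]
    [NormedSpace 𝕜 B] [IsScalarTower 𝕜 B B] [SMulCommClass 𝕜 B B] [CompleteSpace B]
    (φ : A →ₙₐ[𝕜] B) (hφ : Continuous φ) (hd : DenseRange φ) (J : ClosedIdeal 𝕜 B)
    (h : ∀ x ∈ I.toSubmodule, φ x ∈ J.toSubmodule) :
    (ofNorm 𝕜 B).HasBoundedApproximateDiagonalMod J := by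
  classical
  obtain ⟨C, hC, hS⟩ := hS
  obtain ⟨n, K, hK, hn⟩ := S.exists_norm_le (φ : A →ₗ[𝕜] B) hφ
  set T := ofNorm 𝕜 B with hT
  have hq (m : ℕ) (x : I.Quot) : T.pHat J m (I.quotMap J φ h x) ≤ K * S.pHat I n x :=
    S.pHat_quotMap_le T I J φ h hK hn x
  have hf : ∀ m, ∃ n, ∃ c : ℝ, 0 ≤ c ∧
      ∀ x, T.pHat J m (I.quotMap J φ h x) ≤ c * S.pHat I n x := fun m => ⟨n, K, hK.le, hq m⟩
  set R := K * K * C n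
  have hR : 0 ≤ R := by have := hC n; positivity
  refine hasBoundedApproximateDiagonalMod_ofNorm J R fun F ε hε => ?_
  -- Replacing `b` by `φ (a b)` costs at most `2 R δ` in the commutator and `(R + 1) δ` in the
  -- defect; the image of `M` contributes at most `K² η` and `K η`. Each contribution is at most `ε
  -- / 2`.
  set δ := ε / 2 / (2 * R + 1)
  have hδ : 0 < δ := by positivity
  have hδ' : δ * (2 * R + 1) = ε / 2 := div_mul_cancel₀ _ (by positivity)
  set η := ε / 2 / (K * K + K)
  have hη : 0 < η := by positivity
  have hη' : η * (K * K + K) = ε / 2 := div_mul_cancel₀ _ (by positivity)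
  choose a ha using fun b : B => Metric.denseRange_iff.1 hd b δ hδ
  -- An approximant `a b` may fall into `I`; it is then left out, and its commutator and defect are
  -- zero.
  obtain ⟨M, hM, hMc, hMu⟩ := hS ((F.image a).filter (· ∉ I.toSubmodule))
    (fun x hx => (Finset.mem_filter.1 hx).2) n η hη
  have hMc' : ∀ b ∈ F, S.rHat I n (S.commutator I (a b) M) < η := fun b hb => by
    by_cases hI : a b ∈ I.toSubmodule
    · rwa [S.commutator_of_mem I hI, map_zero]
    · exact hMc _ (Finset.mem_filter.2 ⟨Finset.mem_image_of_mem a hb, hI⟩)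
  have hMu' : ∀ b ∈ F, S.pHat I n (S.unitDefect I (a b) M) < η := fun b hb => by
    by_cases hI : a b ∈ I.toSubmodule
    · have : I.proj (a b) = 0 := (Submodule.Quotient.mk_eq_zero _).2 hI
      rwa [unitDefect, I.lmul_of_mem hI, this, LinearMap.zero_apply, sub_zero, map_zero]
    · exact hMu _ (Finset.mem_filter.2 ⟨Finset.mem_image_of_mem a hb, hI⟩)
  set Φ := S.tensorMap T I J φ h hf
  have hΦ (z : S.QuotTensor I) : T.rHat J 0 (Φ z) ≤ K * K * S.rHat I n z :=
    seminorm_mapSquare_le _ _ _ hf hK.le (hq 0) z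
  have hΦM : T.rHat J 0 (Φ M) ≤ R :=
    (hΦ M).trans (mul_le_mul_of_nonneg_left hM (by positivity))
  refine ⟨Φ M, hΦM, fun b hb => ?_⟩
  have hb' : T.p 0 (b - φ (a b)) < δ := by
    have := ha b
    rwa [dist_eq_norm] at this
  have hpR : T.p 0 (b - φ (a b)) * T.rHat J 0 (Φ M) ≤ δ * R :=
    mul_le_mul hb'.le hΦM (apply_nonneg _ _) hδ.le
  have hKη : 0 < K * η := by positivity
  constructor
  · have e : T.commutator J b (Φ M) =
        T.commutator J (b - φ (a b)) (Φ M) + Φ (S.commutator I (a b) M) := by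
      rw [commutator_sub_left, S.tensorMap_commutator T I J φ h hf, sub_add_cancel]
    rw [e]
    have h1 := T.rHat_commutator_le J 0 (b - φ (a b)) (Φ M)
    have h2 := (hΦ (S.commutator I (a b) M)).trans
      (mul_le_mul_of_nonneg_left (hMc' b hb).le (by positivity))
    refine (map_add_le_add _ _ _).trans_lt ?_
    linarith
  · have e : T.unitDefect J b (Φ M) = T.unitDefect J (b - φ (a b)) (Φ M) +
        I.quotMap J φ h (S.unitDefect I (a b) M) := by
      rw [unitDefect_sub_left, S.quotMap_unitDefect T I J φ h hf hφ, sub_add_cancel]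
    rw [e]
    have h1 := T.pHat_unitDefect_le J 0 (b - φ (a b)) (Φ M)
    have h2 := (hq 0 (S.unitDefect I (a b) M)).trans
      (mul_le_mul_of_nonneg_left (hMu' b hb).le hK.le)
    have hδR : 0 ≤ δ * R := by positivity
    have hKKη : 0 < K * K * η := by positivity
    refine (map_add_le_add _ _ _).trans_lt ?_
    linarith

/-- The zero ideal of a Hausdorff algebra. -/
def _root_.ClosedIdeal.zero (𝕜 B : Type*) [RCLike 𝕜] [NonUnitalRing B] [Module 𝕜 B]
    [TopologicalSpace B] [T1Space B] : ClosedIdeal 𝕜 B where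
  toSubmodule := ⊥
  mul_mem_left a x hx := by
    obtain rfl : x = 0 := hx
    exact mul_zero a
  mul_mem_right a x hx := by
    obtain rfl : x = 0 := hx
    exact zero_mul a
  isClosed := isClosed_singleton

theorem pHat_zero_proj {B : Type*} [NonUnitalRing B] [Module 𝕜 B] [TopologicalSpace B] [T1Space B]
    (T : FrechetSeminorms 𝕜 B) (n : ℕ) (b : B) :
    T.pHat (.zero 𝕜 B) n ((ClosedIdeal.zero 𝕜 B).proj b) = T.p n b := by
  refine le_antisymm (quotientSeminorm_mk_le _ _ _) (le_of_not_gt fun hlt => ?_)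
  obtain ⟨a, ha, hab⟩ := exists_lt_of_quotientSeminorm_lt _ _ hlt
  obtain rfl : a = b := sub_eq_zero.1 ((Submodule.Quotient.eq _).1 ha)
  exact hab.false

/-- In a Banach algebra with a bounded approximate diagonal, the approximate solutions for finite
sets have a common bound. -/
theorem HasBoundedApproximateDiagonalMod.exists_bound {B : Type u} [NonUnitalNormedRing B]
    [NormedSpace 𝕜 B] [IsScalarTower 𝕜 B B] [SMulCommClass 𝕜 B B] [CompleteSpace B]
    {J : ClosedIdeal 𝕜 B} (hB : (ofNorm 𝕜 B).HasBoundedApproximateDiagonalMod J) :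
    ∃ C : ℝ, ∀ F : Finset B, ∀ ε : ℝ, 0 < ε → ∃ m : (ofNorm 𝕜 B).QuotTensor J,
      (ofNorm 𝕜 B).rHat J 0 m ≤ C ∧
      ∀ b ∈ F, (ofNorm 𝕜 B).rHat J 0 ((ofNorm 𝕜 B).commutator J b m) < ε ∧
        (ofNorm 𝕜 B).pHat J 0 ((ofNorm 𝕜 B).unitDefect J b m) < ε := by
  obtain ⟨ι, _, _, _, m, hm, hmu, hmc⟩ := hB
  obtain ⟨C, hC⟩ := hm 0
  refine ⟨C, fun F ε hε => ?_⟩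
  -- Finitely many conditions each hold eventually along the net, so one index satisfies them all.
  have hev : ∀ᶠ i in atTop, ∀ b ∈ F,
      (ofNorm 𝕜 B).rHat J 0 ((ofNorm 𝕜 B).commutator J b (m i)) < ε ∧
      (ofNorm 𝕜 B).pHat J 0 ((ofNorm 𝕜 B).unitDefect J b (m i)) < ε := by
    refine (Filter.eventually_all_finset F).2 fun b _ => Eventually.and ?_ ?_
    · by_cases hJ : b ∈ J.toSubmodule
      · exact .of_forall fun i => by rwa [commutator_of_mem _ J hJ, map_zero]
      · have := ((continuous_seminorm _ _ 0).tendsto' _ _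
          (map_zero ((ofNorm 𝕜 B).rHat J 0))).comp (hmc b hJ)
        exact this.eventually_lt_const hε
    · have := (((ofNorm 𝕜 B).withSeminorms_pHat J).tendsto_nhds _ _).1 (hmu b) 0 ε hε
      simpa only [sub_zero] using! this
  obtain ⟨i, hi⟩ := hev.exists
  exact ⟨m i, hC i, hi⟩

variable {S I} in
/-- Approximate solutions can be pulled back along a homomorphism that induces an isometry with
dense range on the quotients. -/
theorem exists_of_quotMap_isometry {B : Type*} [NonUnitalRing B] [Module 𝕜 B]
    [IsScalarTower 𝕜 B B] [SMulCommClass 𝕜 B B] [UniformSpace B] [IsUniformAddGroup B]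
    [CompleteSpace B] {T : FrechetSeminorms 𝕜 B} {J : ClosedIdeal 𝕜 B} {φ : A →ₙₐ[𝕜] B}
    (hφ : Continuous φ) {h : ∀ x ∈ I.toSubmodule, φ x ∈ J.toSubmodule} {k n : ℕ}
    (hf : ∀ m, ∃ n, ∃ c : ℝ, 0 ≤ c ∧ ∀ x, T.pHat J m (I.quotMap J φ h x) ≤ c * S.pHat I n x)
    (hq : ∀ x, T.pHat J k (I.quotMap J φ h x) = S.pHat I n x)
    (hqd : ∀ x, ∀ ε > 0, ∃ e, T.pHat J k (x - I.quotMap J φ h e) < ε) {C : ℝ} (F : Finset A)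
    {ε : ℝ} (hε : 0 < ε) {m : T.QuotTensor J} (hm : T.rHat J k m ≤ C)
    (hmc : ∀ a ∈ F, T.rHat J k (T.commutator J (φ a) m) < ε)
    (hmu : ∀ a ∈ F, T.pHat J k (T.unitDefect J (φ a) m) < ε) :
    ∃ M : S.QuotTensor I, S.rHat I n M ≤ C + 1 ∧
      (∀ a ∈ F, S.rHat I n (S.commutator I a M) < 2 * ε) ∧
      (∀ a ∈ F, S.pHat I n (S.unitDefect I a M) < 2 * ε) := by
  set Φ := S.tensorMap T I J φ h hf
  have hΦ (z : S.QuotTensor I) : T.rHat J k (Φ z) = S.rHat I n z :=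
    seminorm_mapSquare_eq _ _ _ hf hq hqd z
  set L := ∑ a ∈ F, T.p k (φ a)
  have hL : 0 ≤ L := Finset.sum_nonneg fun _ _ => apply_nonneg _ _
  -- `L` dominates every `p (φ a)` with `a ∈ F`, so replacing `m` by `Φ w` costs at most `2 L δ ≤ ε`
  -- in the commutator and `L δ` in the defect; `δ ≤ 1` gives the bound `C + 1`.
  set δ := min 1 (ε / (2 * L + 1))
  have hδ : 0 < δ := by positivity
  have hδ' : δ * (2 * L + 1) ≤ ε := (le_div_iff₀ (by positivity)).1 (min_le_right _ _)
  obtain ⟨w, hw⟩ : ∃ w, T.rHat J k (m - Φ w) < δ :=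
    exists_seminorm_sub_mapSquare_lt (S.pHat I) (T.pHat J) (I.quotMap J φ h) hf hqd m hδ
  have hLδ : ∀ a ∈ F, T.p k (φ a) * T.rHat J k (m - Φ w) ≤ L * δ := fun a ha =>
    mul_le_mul
      (Finset.single_le_sum (f := fun a => T.p k (φ a)) (fun _ _ => apply_nonneg _ _) ha) hw.le
      (apply_nonneg _ _) hL
  have hLδ0 : 0 ≤ L * δ := by positivity
  refine ⟨w, ?_, fun a ha => ?_, fun a ha => ?_⟩
  · rw [← hΦ, ← sub_sub_cancel m (Φ w)]
    refine (map_sub_le_add _ _ _).trans ?_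
    have h1 : δ ≤ 1 := min_le_left _ _
    linarith
  · rw [← hΦ, S.tensorMap_commutator T I J φ h hf, ← sub_sub_cancel m (Φ w), map_sub]
    refine (map_sub_le_add _ _ _).trans_lt ?_
    linarith [hmc a ha, T.rHat_commutator_le J k (φ a) (m - Φ w), hLδ a ha]
  · rw [← hq, S.quotMap_unitDefect T I J φ h hf hφ, T.unitDefect_sub_right J (φ a) m (Φ w)]
    refine (map_sub_le_add _ _ _).trans_lt ?_
    linarith [hmu a ha, T.pHat_lmul_diagonalMap_le J k (φ a) (m - Φ w), hLδ a ha]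

variable {S I} in
-- Modulo the zero ideal the quotient norm is the norm of `B`, so `hn` and `hd` say that `A / I → B
-- / 0` is isometric for `p̂_n` with dense range.
theorem exists_bound_of_hasBoundedApproximateDiagonalMod_zero {B : Type u} [NonUnitalNormedRing B]
    [NormedSpace 𝕜 B] [IsScalarTower 𝕜 B B] [SMulCommClass 𝕜 B B] [CompleteSpace B]
    (φ : A →ₙₐ[𝕜] B) (hφ : Continuous φ) (hd : DenseRange φ) (n : ℕ)
    (hn : ∀ a, ‖φ a‖ = S.pHat I n (I.proj a))
    (h : ∀ x ∈ I.toSubmodule, φ x ∈ (ClosedIdeal.zero 𝕜 B).toSubmodule)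
    (hB : (ofNorm 𝕜 B).HasBoundedApproximateDiagonalMod (.zero 𝕜 B)) :
    ∃ C : ℝ, 0 < C ∧ ∀ F : Finset A, ∀ ε : ℝ, 0 < ε →
      ∃ M : S.QuotTensor I, S.rHat I n M ≤ C ∧
        (∀ a ∈ F, S.rHat I n (S.commutator I a M) < ε) ∧
        (∀ a ∈ F, S.pHat I n (S.unitDefect I a M) < ε) := by
  classical
  obtain ⟨C, hC⟩ := hB.exists_bound
  set T := ofNorm 𝕜 B
  set J := ClosedIdeal.zero 𝕜 B
  have hq (m : ℕ) (x : I.Quot) : T.pHat J m (I.quotMap J φ h x) = S.pHat I n x := by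
    obtain ⟨a, rfl⟩ := I.toSubmodule.mkQ_surjective x
    exact (T.pHat_zero_proj m (φ a)).trans (hn a)
  have hqd : ∀ x, ∀ ε > 0, ∃ e, T.pHat J 0 (x - I.quotMap J φ h e) < ε := fun x ε hε => by
    obtain ⟨b, rfl⟩ := J.toSubmodule.mkQ_surjective x
    obtain ⟨a, ha⟩ := Metric.denseRange_iff.1 hd b ε hε
    refine ⟨I.proj a, ?_⟩
    rw [ClosedIdeal.quotMap_proj, ← map_sub, T.pHat_zero_proj]
    rwa [dist_eq_norm] at ha
  -- The absolute value ensures positivity, and the `1` is the price of the pull-back, which also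
  -- doubles the tolerance; hence `ε / 2` below.
  refine ⟨|C| + 1, by positivity, fun F ε hε => ?_⟩
  obtain ⟨m, hm, hmF⟩ := hC (F.image φ) (ε / 2) (half_pos hε)
  obtain ⟨M, hM⟩ := exists_of_quotMap_isometry hφ
    (fun m => ⟨n, 1, zero_le_one, fun x => (hq m x).trans_le (one_mul _).ge⟩) (hq 0) hqd F
    (half_pos hε) (hm.trans (le_abs_self C))
    (fun a ha => (hmF _ (Finset.mem_image_of_mem φ ha)).1)
    (fun a ha => (hmF _ (Finset.mem_image_of_mem φ ha)).2)
  rw [mul_div_cancel₀ ε two_ne_zero] at hM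
  exact ⟨M, hM⟩

theorem exists_bound_of_forall_banach
    (hS : ∀ (B : Type u) [NonUnitalNormedRing B] [NormedSpace 𝕜 B] [IsScalarTower 𝕜 B B]
      [SMulCommClass 𝕜 B B] [CompleteSpace B] (φ : A →ₙₐ[𝕜] B), Continuous φ → DenseRange φ →
      ∀ J : ClosedIdeal 𝕜 B, (∀ x ∈ I.toSubmodule, φ x ∈ J.toSubmodule) →
        (ofNorm 𝕜 B).HasBoundedApproximateDiagonalMod J) (n : ℕ) :
    ∃ C : ℝ, 0 < C ∧ ∀ F : Finset A, ∀ ε : ℝ, 0 < ε →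
      ∃ M : S.QuotTensor I, S.rHat I n M ≤ C ∧
        (∀ a ∈ F, S.rHat I n (S.commutator I a M) < ε) ∧
        (∀ a ∈ F, S.pHat I n (S.unitDefect I a M) < ε) := by
  -- Completing for `p̂_n(a + I)` rather than `p_n(a)` forces `φ` to vanish on `I`, which allows `J
  -- = 0`.
  obtain ⟨B, _, _, _, _, _, φ, hd, hn⟩ := exists_banach_completion_of_seminorm
    ((S.pHat I n).comp I.proj) fun a b => S.pHat_mulQuot_le I n (I.proj a) (I.proj b)
  have hφ : Continuous φ :=
    WithSeminorms.continuous_of_isBounded S.withSeminorms (norm_withSeminorms 𝕜 B) (φ : A →ₗ[𝕜] B)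
      (Seminorm.IsBounded.of_real fun _ => ⟨{n}, 1, fun a => by
        rw [Finset.sup_singleton, one_mul]
        exact (hn a).trans_le (quotientSeminorm_mk_le _ _ a)⟩)
  have h : ∀ x ∈ I.toSubmodule, φ x ∈ (ClosedIdeal.zero 𝕜 B).toSubmodule := fun x hx => by
    have hx' : I.proj x = 0 := (Submodule.Quotient.mk_eq_zero _).2 hx
    refine (Submodule.mem_bot 𝕜).2 (norm_eq_zero.1 ?_)
    rw [hn, Seminorm.comp_apply, hx', map_zero]
  exact exists_bound_of_hasBoundedApproximateDiagonalMod_zero φ hφ hd n hn h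
    (hS B φ hφ hd _ h)

end FrechetSeminorms

end

/-- A Fréchet algebra `(A, p_n)` has a locally bounded approximate diagonal modulo the closed ideal
`I` if and only if, for every continuous homomorphism `φ` with dense range from `A` to a Banach
algebra `B` and every closed ideal `J` of `B` with `φ(I) ⊆ J`, the Banach algebra `B` has a bounded
approximate diagonal modulo `J`. -/
theorem propositionp8 {𝕜 : Type*} {A : Type u} [RCLike 𝕜] [NonUnitalRing A] [Module 𝕜 A]
    [IsScalarTower 𝕜 A A] [SMulCommClass 𝕜 A A] [UniformSpace A] [IsUniformAddGroup A]
    [CompleteSpace A] [T2Space A] (S : FrechetSeminorms 𝕜 A) (I : ClosedIdeal 𝕜 A) :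
    S.HasLocallyBoundedApproximateDiagonalMod I ↔
      ∀ (B : Type u) [NonUnitalNormedRing B] [NormedSpace 𝕜 B] [IsScalarTower 𝕜 B B]
        [SMulCommClass 𝕜 B B] [CompleteSpace B] (φ : A →ₙₐ[𝕜] B), Continuous φ → DenseRange φ →
        ∀ J : ClosedIdeal 𝕜 B, (∀ x ∈ I.toSubmodule, φ x ∈ J.toSubmodule) →
          (FrechetSeminorms.ofNorm 𝕜 B).HasBoundedApproximateDiagonalMod J := by
  refine ⟨fun hS B _ _ _ _ _ φ hφ hd J h => hS.ofNorm_of_denseRange φ hφ hd J h, fun hS => ?_⟩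
  choose C hC hM using S.exists_bound_of_forall_banach I hS
  exact ⟨C, hC, fun F _ n ε hε => hM n F ε hε⟩
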